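/- Let $\Gamma$ be a discrete group with identity $e$ and let $\sigma\colon\Gamma\times\Gamma\to\mathbb T$ be a 2-cocycle, that is, $\sigma(x,y)\sigma(xy,z)=\sigma(x,yz)\sigma(y,z)$ for all $x,y,z\in\Gamma$ and $\sigma(e,e)=1$. For $x\in\Gamma$ let $\lambda_\sigma(x)$ be the unitary operator on $\ell^2(\Gamma)$ given by $(\lambda_\sigma(x)f)(y)=\sigma(x,x^{-1}y)f(x^{-1}y)$, and let $M=\mathrm{vN}(\Gamma,\sigma)=\lambda_\sigma(\Gamma)''$ be the $\sigma$-twisted group von Neumann algebra, with center $\mathcal Z(M)=M\cap M'$. There is exactly one bounded linear map $\mathrm{Tr}\colon M\to\mathcal Z(M)$, the center-valued trace of $M$, that is normal (continuous for the ultraweak topologies) and satisfies (1) $\mathrm{Tr}(ab)=\mathrm{Tr}(ba)$ for all $a,b\in M$; (2) $\mathrm{Tr}(ba)=b\,\mathrm{Tr}(a)$ for all $a\in M$, $b\in\mathcal Z(M)$; (3) $\mathrm{Tr}(a)=a$ for all $a\in\mathcal Z(M)$; (4) for $a\in M$, $\mathrm{Tr}(a^*a)=0$ implies $a=0$. Call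 $x\in\Gamma$ $\sigma$-regular if $\sigma(x,y)=\sigma(y,x)$ for every $y\in\Gamma$ commuting with $x$, and call a conjugacy class $\sigma$-regular if all its elements are. The map $\mathrm{Tr}$ is given as follows. Let $\gamma\in\Gamma$ have conjugacy class $C_\gamma$. If $C_\gamma$ is finite and $\sigma$-regular, and $C_\gamma=\{\beta_1^{-1}\gamma\beta_1,\dots,\beta_k^{-1}\gamma\beta_k\}$ with $\beta_1,\dots,\beta_k\in\Gamma$ and $k=|C_\gamma|$ (so the listed elements are distinct), then $$\mathrm{Tr}(\lambda_\sigma(\gamma))=|C_\gamma|^{-1}\sum_{j=1}^k\sigma(\gamma,\beta_j)\,\overline{\sigma(\beta_j,\beta_j^{-1}\gamma\beta_j)}\,\lambda_\sigma(\beta_j^{-1}\gamma\beta_j).$$ Otherwise, i.e. if $C_\gamma$ is infinite or not $\sigma$-regular, $\mathrm{Tr}(\lambda_\sigma(\gamma))=0$. -/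

import Mathlib

open scoped ENNReal ComplexConjugate

/-- A 2-cocycle on the (discrete) group `Γ` with values in the unit circle,
normalized by `σ(e, e) = 1`. -/
structure TwoCocycle (Γ : Type*) [Group Γ] where
  toFun : Γ → Γ → Circle
  cocycle : ∀ x y z : Γ, toFun x y * toFun (x * y) z = toFun x (y * z) * toFun y z
  map_one_one : toFun 1 1 = 1

namespace TwoCocycle

instance {Γ : Type*} [Group Γ] : CoeFun (TwoCocycle Γ) (fun _ => Γ → Γ → Circle) :=
  ⟨TwoCocycle.toFun⟩

/-- An element `x` is `σ`-regular if `σ(x, y) = σ(y, x)` whenever `y` commutes with `x`. -/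
def IsRegular {Γ : Type*} [Group Γ] (σ : TwoCocycle Γ) (x : Γ) : Prop :=
  ∀ y : Γ, Commute y x → σ x y = σ y x

/-- The conjugacy class `C_γ` of `γ` is `σ`-regular if all of its elements are. -/
def IsRegularClass {Γ : Type*} [Group Γ] (σ : TwoCocycle Γ) (γ : Γ) : Prop :=
  ∀ x ∈ conjugatesOf γ, σ.IsRegular x

theorem map_one_left {Γ : Type*} [Group Γ] (σ : TwoCocycle Γ) (x : Γ) : σ 1 x = 1 := by
  have h := σ.cocycle 1 1 x
  simp only [one_mul, σ.map_one_one] at h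
  exact left_eq_mul.mp h

end TwoCocycle

/-- The Hilbert space `ℓ²(Γ)`. -/
abbrev EllTwo (Γ : Type*) : Type _ := lp (fun _ : Γ => ℂ) 2

noncomputable section

namespace TwoCocycle

/-- The function `y ↦ σ(x, x⁻¹ y) f(x⁻¹ y)`. -/
def leftRegularFun {Γ : Type*} [Group Γ] (σ : TwoCocycle Γ) (x : Γ) (f : Γ → ℂ) : Γ → ℂ :=
  fun y => (σ x (x⁻¹ * y) : ℂ) * f (x⁻¹ * y)

theorem norm_leftRegularFun {Γ : Type*} [Group Γ] (σ : TwoCocycle Γ) (x : Γ) (f : Γ → ℂ)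
    (y : Γ) : ‖σ.leftRegularFun x f y‖ = ‖f (x⁻¹ * y)‖ := by
  rw [leftRegularFun, norm_mul, Circle.norm_coe, one_mul]

theorem memℓp_leftRegularFun {Γ : Type*} [Group Γ] (σ : TwoCocycle Γ) (x : Γ)
    (f : EllTwo Γ) : Memℓp (σ.leftRegularFun x f) 2 := by
  have h := lp.memℓp f
  rw [memℓp_gen_iff (by norm_num)] at h ⊢
  simp only [norm_leftRegularFun]
  exact (Equiv.mulLeft x⁻¹).summable_iff.mpr h

/-- The `σ`-projective left regular representation on `ℓ²(Γ)`, as linear isometries: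
`(λ_σ(x) f)(y) = σ(x, x⁻¹ y) f(x⁻¹ y)`. -/
def leftRegularIsometry {Γ : Type*} [Group Γ] (σ : TwoCocycle Γ) (x : Γ) :
    EllTwo Γ →ₗᵢ[ℂ] EllTwo Γ where
  toFun f := ⟨σ.leftRegularFun x f, σ.memℓp_leftRegularFun x f⟩
  map_add' f g := by
    ext y
    exact mul_add _ _ _
  map_smul' c f := by
    ext y
    exact mul_left_comm _ _ _
  norm_map' f := by
    rw [lp.norm_eq_tsum_rpow (by norm_num), lp.norm_eq_tsum_rpow (by norm_num)]
    congr 1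
    simp only [LinearMap.coe_mk, AddHom.coe_mk, norm_leftRegularFun]
    exact (Equiv.mulLeft x⁻¹).tsum_eq (fun y => ‖f y‖ ^ (2 : ℝ≥0∞).toReal)

/-- The bounded operator `λ_σ(x)` on `ℓ²(Γ)`. -/
def leftRegular {Γ : Type*} [Group Γ] (σ : TwoCocycle Γ) (x : Γ) :
    EllTwo Γ →L[ℂ] EllTwo Γ :=
  (σ.leftRegularIsometry x).toContinuousLinearMap

theorem leftRegular_apply {Γ : Type*} [Group Γ] (σ : TwoCocycle Γ) (x : Γ) (f : EllTwo Γ)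
    (y : Γ) : σ.leftRegular x f y = (σ x (x⁻¹ * y) : ℂ) * f (x⁻¹ * y) := rfl

theorem leftRegular_one {Γ : Type*} [Group Γ] (σ : TwoCocycle Γ) : σ.leftRegular 1 = 1 := by
  ext f y
  simp [leftRegular_apply, map_one_left]

/-- `λ_σ(x) λ_σ(y) = σ(x, y) λ_σ(xy)`. -/
theorem leftRegular_mul {Γ : Type*} [Group Γ] (σ : TwoCocycle Γ) (x y : Γ) :
    σ.leftRegular x * σ.leftRegular y = (σ x y : ℂ) • σ.leftRegular (x * y) := by
  ext f z
  have h := congrArg (fun c : Circle => (c : ℂ)) (σ.cocycle x y ((x * y)⁻¹ * z))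
  have e1 : y * ((x * y)⁻¹ * z) = x⁻¹ * z := by group
  have e2 : (x * y)⁻¹ * z = y⁻¹ * (x⁻¹ * z) := by group
  rw [e1] at h
  simp only [Circle.coe_mul] at h
  calc (σ.leftRegular x * σ.leftRegular y) f z
      = (σ x (x⁻¹ * z) : ℂ) * ((σ y (y⁻¹ * (x⁻¹ * z)) : ℂ) * f (y⁻¹ * (x⁻¹ * z))) := rfl
    _ = (σ x y : ℂ) * ((σ (x * y) ((x * y)⁻¹ * z) : ℂ) * f ((x * y)⁻¹ * z)) := by
        rw [← e2, ← mul_assoc, ← mul_assoc, h]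
    _ = ((σ x y : ℂ) • σ.leftRegular (x * y)) f z := rfl

theorem star_leftRegular_mul {Γ : Type*} [Group Γ] (σ : TwoCocycle Γ) (x : Γ) :
    star (σ.leftRegular x) * σ.leftRegular x = 1 :=
  (σ.leftRegularIsometry x).adjoint_comp_self

theorem star_leftRegular {Γ : Type*} [Group Γ] (σ : TwoCocycle Γ) (x : Γ) :
    star (σ.leftRegular x) = ((σ x x⁻¹ : ℂ)⁻¹) • σ.leftRegular x⁻¹ := by
  have h : σ.leftRegular x * (((σ x x⁻¹ : ℂ)⁻¹) • σ.leftRegular x⁻¹) = 1 := by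
    rw [mul_smul_comm, leftRegular_mul, smul_smul, inv_mul_cancel₀ (Circle.coe_ne_zero _),
      one_smul, mul_inv_cancel, leftRegular_one]
  exact left_inv_eq_right_inv (σ.star_leftRegular_mul x) h

theorem star_mem_centralizer_range {Γ : Type*} [Group Γ] (σ : TwoCocycle Γ)
    {a : EllTwo Γ →L[ℂ] EllTwo Γ} (ha : a ∈ Set.centralizer (Set.range σ.leftRegular)) :
    star a ∈ Set.centralizer (Set.range σ.leftRegular) := by
  rintro _ ⟨x, rfl⟩
  have h1 : star (σ.leftRegular x) * a = a * star (σ.leftRegular x) := by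
    rw [star_leftRegular, smul_mul_assoc, mul_smul_comm, ha _ ⟨x⁻¹, rfl⟩]
  have h2 := congrArg star h1
  simpa using h2.symm

/-- The `σ`-twisted group von Neumann algebra `vN(Γ, σ) = λ_σ(Γ)''`. -/
def twistedVN {Γ : Type*} [Group Γ] (σ : TwoCocycle Γ) : VonNeumannAlgebra (EllTwo Γ) where
  toSubalgebra :=
    Subalgebra.centralizer ℂ (Set.centralizer (Set.range σ.leftRegular))
  star_mem' := by
    intro a ha b hb
    have h := congrArg star (ha (star b) (σ.star_mem_centralizer_range hb))
    simpa using h.symm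
  centralizer_centralizer' := by
    simp

theorem coe_twistedVN {Γ : Type*} [Group Γ] (σ : TwoCocycle Γ) :
    (σ.twistedVN : Set (EllTwo Γ →L[ℂ] EllTwo Γ)) =
      Set.centralizer (Set.centralizer (Set.range σ.leftRegular)) := rfl

theorem leftRegular_mem {Γ : Type*} [Group Γ] (σ : TwoCocycle Γ) (x : Γ) :
    σ.leftRegular x ∈ σ.twistedVN.toStarSubalgebra :=
  Set.subset_centralizer_centralizer (Set.mem_range_self x)

/-- `λ_σ(x)` as an element of `vN(Γ, σ)`. -/
def twistedUnitary {Γ : Type*} [Group Γ] (σ : TwoCocycle Γ) (x : Γ) :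
    σ.twistedVN.toStarSubalgebra :=
  ⟨σ.leftRegular x, σ.leftRegular_mem x⟩

end TwoCocycle

namespace VonNeumannAlgebra

/-- The center `Z(M) = M ∩ M'` of a von Neumann algebra, again a von Neumann algebra. -/
def centerVN {H : Type*} [NormedAddCommGroup H] [InnerProductSpace ℂ H] [CompleteSpace H]
    (M : VonNeumannAlgebra H) : VonNeumannAlgebra H where
  toStarSubalgebra := M.toStarSubalgebra ⊓ M.commutant.toStarSubalgebra
  centralizer_centralizer' := by
    have h : (M.toStarSubalgebra ⊓ M.commutant.toStarSubalgebra).carrier =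
        Set.centralizer ((M.commutant : Set (H →L[ℂ] H)) ∪ (M : Set (H →L[ℂ] H))) := by
      rw [Set.centralizer_union, ← coe_commutant, ← coe_commutant, commutant_commutant]
      rfl
    rw [h, Set.centralizer_centralizer_centralizer]

theorem mem_centerVN {H : Type*} [NormedAddCommGroup H] [InnerProductSpace ℂ H]
    [CompleteSpace H] (M : VonNeumannAlgebra H) (a : H →L[ℂ] H) :
    a ∈ M.centerVN ↔ a ∈ M ∧ ∀ b ∈ M, b * a = a * b := by
  rw [← mem_commutant_iff]
  rfl

/-- The ultraweak (σ-weak) topology on `B(H)`: the coarsest topology for which all the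
functionals `a ↦ ∑ₙ ⟨a ξₙ, ηₙ⟩` with `∑ₙ ‖ξₙ‖² < ∞` and `∑ₙ ‖ηₙ‖² < ∞` are continuous. -/
abbrev ultraweakTopology (H : Type*) [NormedAddCommGroup H] [InnerProductSpace ℂ H] :
    TopologicalSpace (H →L[ℂ] H) :=
  ⨅ (ξ : lp (fun _ : ℕ => H) 2) (η : lp (fun _ : ℕ => H) 2),
    TopologicalSpace.induced (fun a : H →L[ℂ] H => ∑' n, inner ℂ (η n) (a (ξ n))) inferInstance

/-- A linear map between von Neumann algebras is normal if it is continuous for the ultraweak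
topologies. -/
def IsNormalMap {H K : Type*} [NormedAddCommGroup H] [InnerProductSpace ℂ H] [CompleteSpace H]
    [NormedAddCommGroup K] [InnerProductSpace ℂ K] [CompleteSpace K]
    {M : VonNeumannAlgebra H} {N : VonNeumannAlgebra K}
    (T : M.toStarSubalgebra →ₗ[ℂ] N.toStarSubalgebra) : Prop :=
  @Continuous _ _ ((ultraweakTopology H).induced Subtype.val)
    ((ultraweakTopology K).induced Subtype.val) T

/-- A bounded linear map `Tr : M → Z(M)` is a center-valued trace if it is normal, tracial,
`Z(M)`-linear, the identity on `Z(M)`, and faithful. -/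
structure IsCenterValuedTrace {H : Type*} [NormedAddCommGroup H] [InnerProductSpace ℂ H]
    [CompleteSpace H] (M : VonNeumannAlgebra H)
    (Tr : M.toStarSubalgebra →L[ℂ] M.centerVN.toStarSubalgebra) : Prop where
  normal : IsNormalMap Tr.toLinearMap
  map_mul_comm : ∀ a b : M.toStarSubalgebra, Tr (a * b) = Tr (b * a)
  map_center_mul : ∀ a b : M.toStarSubalgebra, (b : H →L[ℂ] H) ∈ M.centerVN →
    (Tr (b * a) : H →L[ℂ] H) = (b : H →L[ℂ] H) * (Tr a : H →L[ℂ] H)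
  map_center : ∀ a : M.toStarSubalgebra, (a : H →L[ℂ] H) ∈ M.centerVN →
    (Tr a : H →L[ℂ] H) = (a : H →L[ℂ] H)
  faithful : ∀ a : M.toStarSubalgebra, Tr (star a * a) = 0 → a = 0

end VonNeumannAlgebra

end

/-! Write `M` for the twisted algebra, `λ` and `ρ` for its left and right regular representations,
`δ_x` for point masses, and `P` for the projection onto the closed space `K` of central vectors,
those `f` with `λ(x) f = ρ(x) f` for all `x`. Since `ρ` commutes with `M`, an operator in `M` is
determined by its value at `δ_e`, and the vector state at `δ_e` is tracial.

Existence: given `a` in `M`, take the vector of least norm in the closure of the values at `δ_e` of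
convex averages of the conjugates `λ(x) a λ(x)*`. By uniqueness of the minimum it lies in `K`;
pairings with `K` are constant on averages, so it equals `P (a δ_e)`. The averages are bounded by
`‖a‖`, hence a sequence of them converges strongly to an operator `E(a)` with `E(a) δ_e = P (a
δ_e)`, which is central (`exists_central_average`). The algebraic properties of `E` follow from
those of `P` and from traciality of the state. For normality, `⟨f, E(a) f⟩ = ⟨f, a f⟩` for `f` in
`K`, and every positive normal functional on the center, after adding the trace, is given by a
vector of `K`. That vector comes from a polar decomposition (`exists_central_vector`).

Uniqueness: any center-valued trace is constant on averages of conjugates of `a`; these converge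
ultraweakly to `E(a)`, which the trace fixes.

Formula: a vector in `K` has constant modulus on conjugacy classes and vanishes where regularity
fails, so `P δ_γ = 0` unless the class is finite and regular. In that case the sum of the `λ(β_j)*
λ(γ) λ(β_j)` is central, and applying the trace to it gives the formula. -/

noncomputable section

namespace TwoCocycle

/-! ### Point masses in `ℓ²(Γ)` -/

section PointMass

variable {Γ : Type*}

open Classical in
/-- The point mass at `x`, as a unit vector of `ℓ²(Γ)`. -/
def pointMass (x : Γ) : EllTwo Γ := lp.single 2 x 1

open Classical in
theorem pointMass_apply (x y : Γ) : pointMass x y = if y = x then 1 else 0 := by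
  rw [pointMass, lp.single_apply, Pi.single_apply]

theorem inner_pointMass (x : Γ) (f : EllTwo Γ) : inner ℂ (pointMass x) f = f x := by
  classical
  rw [pointMass, lp.inner_single_left]
  simp

theorem dense_span_pointMass :
    Dense (Submodule.span ℂ (Set.range (pointMass : Γ → EllTwo Γ)) : Set (EllTwo Γ)) := by
  classical
  intro f
  refine mem_closure_of_tendsto (lp.hasSum_single (by norm_num) f) (Filter.Eventually.of_forall
    fun s => Submodule.sum_mem _ fun x _ => ?_)
  have h : lp.single 2 x (f x) = f x • pointMass x := by
    rw [pointMass, ← lp.single_smul]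
    simp
  rw [h]
  exact Submodule.smul_mem _ _ (Submodule.subset_span ⟨x, rfl⟩)

end PointMass

/-! ### The right regular representation and the canonical trace -/

variable {Γ : Type*} [Group Γ] (σ : TwoCocycle Γ)

theorem map_one_right (x : Γ) : σ x 1 = 1 := by
  have h := σ.cocycle x 1 1
  simp only [mul_one, σ.map_one_one] at h
  simpa using h

theorem map_inv_comm (x : Γ) : σ x x⁻¹ = σ x⁻¹ x := by
  have h := σ.cocycle x x⁻¹ x
  simpa [map_one_left, map_one_right] using h

theorem leftRegular_pointMass (x y : Γ) :
    σ.leftRegular x (pointMass y) = (σ x y : ℂ) • pointMass (x * y) := by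
  ext z
  have e : (σ.leftRegular x (pointMass y) : EllTwo Γ) z
      = (σ x (x⁻¹ * z) : ℂ) * pointMass y (x⁻¹ * z) := rfl
  rw [e, lp.coeFn_smul, Pi.smul_apply, pointMass_apply, pointMass_apply, smul_eq_mul]
  by_cases h : z = x * y
  · simp [h]
  · have h' : ¬ x⁻¹ * z = y := fun h' => h (by rw [← h']; group)
    simp [h, h']

theorem leftRegular_pointMass_one (x : Γ) :
    σ.leftRegular x (pointMass 1) = pointMass x := by
  rw [leftRegular_pointMass, map_one_right]
  simp

theorem norm_leftRegular_apply (x : Γ) (f : EllTwo Γ) : ‖σ.leftRegular x f‖ = ‖f‖ :=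
  (σ.leftRegularIsometry x).norm_map f

theorem leftRegular_mul_star (x : Γ) : σ.leftRegular x * star (σ.leftRegular x) = 1 := by
  rw [star_leftRegular, mul_smul_comm, leftRegular_mul, smul_smul,
    inv_mul_cancel₀ (Circle.coe_ne_zero _), one_smul, mul_inv_cancel, leftRegular_one]

theorem norm_leftRegular_le (x : Γ) : ‖σ.leftRegular x‖ ≤ 1 :=
  (σ.leftRegularIsometry x).norm_toContinuousLinearMap_le

/-- The function `y ↦ σ(y x⁻¹, x) f(y x⁻¹)`. -/
def rightRegularFun (x : Γ) (f : Γ → ℂ) : Γ → ℂ :=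
  fun y => (σ (y * x⁻¹) x : ℂ) * f (y * x⁻¹)

theorem norm_rightRegularFun (x : Γ) (f : Γ → ℂ) (y : Γ) :
    ‖σ.rightRegularFun x f y‖ = ‖f (y * x⁻¹)‖ := by
  rw [rightRegularFun, norm_mul, Circle.norm_coe, one_mul]

theorem memℓp_rightRegularFun (x : Γ) (f : EllTwo Γ) : Memℓp (σ.rightRegularFun x f) 2 := by
  have h := lp.memℓp f
  rw [memℓp_gen_iff (by norm_num)] at h ⊢
  simp only [norm_rightRegularFun]
  exact (Equiv.mulRight x⁻¹).summable_iff.mpr h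

/-- The `σ`-projective right regular representation, as linear isometries:
`(ρ_σ(x) f)(y) = σ(y x⁻¹, x) f(y x⁻¹)`. -/
def rightRegularIsometry (x : Γ) : EllTwo Γ →ₗᵢ[ℂ] EllTwo Γ where
  toFun f := ⟨σ.rightRegularFun x f, σ.memℓp_rightRegularFun x f⟩
  map_add' f g := by
    ext y
    exact mul_add _ _ _
  map_smul' c f := by
    ext y
    exact mul_left_comm _ _ _
  norm_map' f := by
    rw [lp.norm_eq_tsum_rpow (by norm_num), lp.norm_eq_tsum_rpow (by norm_num)]
    congr 1
    simp only [LinearMap.coe_mk, AddHom.coe_mk, norm_rightRegularFun]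
    exact (Equiv.mulRight x⁻¹).tsum_eq (fun y => ‖f y‖ ^ (2 : ℝ≥0∞).toReal)

/-- The bounded operator `ρ_σ(x)` on `ℓ²(Γ)`. -/
def rightRegular (x : Γ) : EllTwo Γ →L[ℂ] EllTwo Γ :=
  (σ.rightRegularIsometry x).toContinuousLinearMap

theorem rightRegular_apply (x : Γ) (f : EllTwo Γ) (y : Γ) :
    σ.rightRegular x f y = (σ (y * x⁻¹) x : ℂ) * f (y * x⁻¹) := rfl

theorem norm_rightRegular_apply (x : Γ) (f : EllTwo Γ) : ‖σ.rightRegular x f‖ = ‖f‖ :=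
  (σ.rightRegularIsometry x).norm_map f

theorem star_rightRegular_mul (x : Γ) : star (σ.rightRegular x) * σ.rightRegular x = 1 :=
  (σ.rightRegularIsometry x).adjoint_comp_self

theorem rightRegular_pointMass_one (x : Γ) :
    σ.rightRegular x (pointMass 1) = pointMass x := by
  ext z
  rw [rightRegular_apply, pointMass_apply, pointMass_apply]
  by_cases h : z = x
  · simp [h, map_one_left]
  · simp [h, mul_inv_eq_one]

/-- Evaluated at `y`, commutation with `λ(z)` is the cocycle identity for `(z, z⁻¹ y x⁻¹, x)`. -/
theorem rightRegular_mem_centralizer (x : Γ) :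
    σ.rightRegular x ∈ Set.centralizer (Set.range σ.leftRegular) := by
  rintro _ ⟨z, rfl⟩
  ext f y
  have h := congrArg (fun c : Circle => (c : ℂ)) (σ.cocycle z (z⁻¹ * y * x⁻¹) x)
  have e1 : z * (z⁻¹ * y * x⁻¹) = y * x⁻¹ := by group
  have e2 : z⁻¹ * y * x⁻¹ * x = z⁻¹ * y := by group
  rw [e1, e2] at h
  simp only [Circle.coe_mul] at h
  calc (σ.leftRegular z * σ.rightRegular x) f y
      = (σ z (z⁻¹ * y) : ℂ) * ((σ (z⁻¹ * y * x⁻¹) x : ℂ) * f (z⁻¹ * y * x⁻¹)) := rfl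
    _ = (σ (y * x⁻¹) x : ℂ) * ((σ z (z⁻¹ * (y * x⁻¹)) : ℂ) * f (z⁻¹ * (y * x⁻¹))) := by
        rw [← mul_assoc z⁻¹, ← mul_assoc, ← mul_assoc, ← h]
        ring
    _ = (σ.rightRegular x * σ.leftRegular z) f y := rfl

theorem mem_twistedVN {a : EllTwo Γ →L[ℂ] EllTwo Γ} :
    a ∈ σ.twistedVN ↔ ∀ b ∈ Set.centralizer (Set.range σ.leftRegular), b * a = a * b := Iff.rfl

theorem leftRegular_mem_twistedVN (x : Γ) : σ.leftRegular x ∈ σ.twistedVN := σ.leftRegular_mem x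

theorem mem_center_of_commute_leftRegular {a : EllTwo Γ →L[ℂ] EllTwo Γ} (ha : a ∈ σ.twistedVN)
    (h : ∀ x, σ.leftRegular x * a = a * σ.leftRegular x) : a ∈ σ.twistedVN.centerVN := by
  rw [VonNeumannAlgebra.mem_centerVN]
  refine ⟨ha, fun b hb => (σ.mem_twistedVN.1 hb a ?_).symm⟩
  rintro _ ⟨x, rfl⟩
  exact h x

variable {σ} {a b : EllTwo Γ →L[ℂ] EllTwo Γ}

theorem apply_rightRegular (ha : a ∈ σ.twistedVN) (x : Γ) (f : EllTwo Γ) :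
    a (σ.rightRegular x f) = σ.rightRegular x (a f) :=
  (DFunLike.congr_fun (ha _ (σ.rightRegular_mem_centralizer x)) f).symm

theorem apply_star_rightRegular (ha : a ∈ σ.twistedVN) (x : Γ) (f : EllTwo Γ) :
    a (star (σ.rightRegular x) f) = star (σ.rightRegular x) (a f) :=
  (DFunLike.congr_fun
    (ha _ (σ.star_mem_centralizer_range (σ.rightRegular_mem_centralizer x))) f).symm

theorem apply_pointMass (ha : a ∈ σ.twistedVN) (x : Γ) :
    a (pointMass x) = σ.rightRegular x (a (pointMass 1)) := by
  rw [← σ.rightRegular_pointMass_one, apply_rightRegular ha]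

/-- The vector `δ_e` is separating for `vN(Γ, σ)`. -/
theorem eq_of_apply_pointMass_one_eq (ha : a ∈ σ.twistedVN) (hb : b ∈ σ.twistedVN)
    (h : a (pointMass 1) = b (pointMass 1)) : a = b := by
  refine ContinuousLinearMap.ext_on dense_span_pointMass ?_
  rintro _ ⟨x, rfl⟩
  rw [apply_pointMass ha, apply_pointMass hb, h]

-- `ρ(x)` commutes with `λ(x)*`, so it sends `λ(x)* δ_e` to `λ(x)* δ_x = δ_e`; applying `ρ(x)*`
-- gives the claim from the isometry property alone.
variable (σ) in
theorem star_leftRegular_pointMass_one (x : Γ) :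
    star (σ.leftRegular x) (pointMass 1) = star (σ.rightRegular x) (pointMass 1) := by
  have h : σ.rightRegular x (star (σ.leftRegular x) (pointMass 1)) = pointMass 1 := by
    rw [← apply_rightRegular (star_mem (σ.leftRegular_mem_twistedVN x)),
      rightRegular_pointMass_one, ← σ.leftRegular_pointMass_one]
    exact DFunLike.congr_fun (σ.star_leftRegular_mul x) _
  conv_rhs => rw [← h]
  exact (DFunLike.congr_fun (σ.star_rightRegular_mul x) _).symm

theorem star_apply_pointMass_one_apply (ha : a ∈ σ.twistedVN) (x : Γ) :
    star a (pointMass 1) x = conj ((σ x x⁻¹ : ℂ) * a (pointMass 1) x⁻¹) := by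
  rw [← inner_pointMass, ContinuousLinearMap.star_eq_adjoint,
    ContinuousLinearMap.adjoint_inner_right, apply_pointMass ha,
    ← ContinuousLinearMap.adjoint_inner_right, ← ContinuousLinearMap.star_eq_adjoint,
    ← star_leftRegular_pointMass_one, ContinuousLinearMap.star_eq_adjoint,
    ContinuousLinearMap.adjoint_inner_right, ← inner_conj_symm, inner_pointMass,
    leftRegular_apply, mul_one]

/-- The canonical vector state of `vN(Γ, σ)` is tracial. -/
theorem inner_mul_comm (ha : a ∈ σ.twistedVN) (hb : b ∈ σ.twistedVN) :
    inner ℂ (pointMass 1) ((a * b) (pointMass 1)) =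
      inner ℂ (pointMass 1) ((b * a) (pointMass 1)) := by
  have key : ∀ {a b : EllTwo Γ →L[ℂ] EllTwo Γ}, a ∈ σ.twistedVN →
      inner ℂ (pointMass 1) ((a * b) (pointMass 1)) =
        ∑' x, (σ x x⁻¹ : ℂ) * a (pointMass 1) x⁻¹ * b (pointMass 1) x := by
    intro a b ha
    rw [mul_apply_eq_comp, ← ContinuousLinearMap.adjoint_inner_left,
      lp.inner_eq_tsum]
    refine tsum_congr fun x => ?_
    rw [← ContinuousLinearMap.star_eq_adjoint, star_apply_pointMass_one_apply ha]
    simp [mul_comm]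
  -- The substitution `x ↦ x⁻¹` exchanges the two factors, because `σ(x, x⁻¹) = σ(x⁻¹, x)`.
  rw [key ha, key hb, ← (Equiv.inv Γ).tsum_eq]
  refine tsum_congr fun x => ?_
  simp only [Equiv.inv_apply, inv_inv, map_inv_comm σ x]
  ring

theorem norm_star_apply_pointMass_one (ha : a ∈ σ.twistedVN) :
    ‖star a (pointMass 1)‖ = ‖a (pointMass 1)‖ := by
  have h := inner_mul_comm ha (star_mem ha)
  have h1 := ContinuousLinearMap.adjoint_inner_left a (ContinuousLinearMap.adjoint a (pointMass 1))
    (pointMass 1)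
  have h2 := ContinuousLinearMap.adjoint_inner_right a (pointMass 1) (a (pointMass 1))
  rw [mul_apply_eq_comp, mul_apply_eq_comp, ContinuousLinearMap.star_eq_adjoint, ← h1, h2,
    inner_self_eq_norm_sq_to_K, inner_self_eq_norm_sq_to_K] at h
  have h' : ‖ContinuousLinearMap.adjoint a (pointMass 1)‖ ^ 2 = ‖a (pointMass 1)‖ ^ 2 := by
    exact_mod_cast h
  exact (sq_eq_sq₀ (norm_nonneg _) (norm_nonneg _)).1 h'

/-! ### Central vectors -/

variable (σ) in
/-- The closed subspace of vectors on which the left and right regular representations agree. -/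
def centralVectors : Submodule ℂ (EllTwo Γ) :=
  ⨅ x, (σ.leftRegular x - σ.rightRegular x).ker

theorem mem_centralVectors {f : EllTwo Γ} :
    f ∈ σ.centralVectors ↔ ∀ x, σ.leftRegular x f = σ.rightRegular x f := by
  simp [centralVectors, sub_eq_zero]

variable (σ) in
theorem isClosed_centralVectors : IsClosed (σ.centralVectors : Set (EllTwo Γ)) := by
  have h : (σ.centralVectors : Set (EllTwo Γ)) =
      ⋂ x, {f | σ.leftRegular x f = σ.rightRegular x f} := by
    ext f
    simp [mem_centralVectors]
  rw [h]
  exact isClosed_iInter fun x => isClosed_eq (by fun_prop) (by fun_prop)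

instance : CompleteSpace σ.centralVectors := σ.isClosed_centralVectors.completeSpace_coe

theorem apply_pointMass_one_mem_centralVectors (ha : a ∈ σ.twistedVN.centerVN) :
    a (pointMass 1) ∈ σ.centralVectors := by
  rw [VonNeumannAlgebra.mem_centerVN] at ha
  refine mem_centralVectors.2 fun x => ?_
  rw [← apply_rightRegular ha.1, rightRegular_pointMass_one, ← σ.leftRegular_pointMass_one x]
  exact DFunLike.congr_fun (ha.2 _ (σ.leftRegular_mem_twistedVN x)) _

theorem star_leftRegular_eq_star_rightRegular {f : EllTwo Γ} (hf : f ∈ σ.centralVectors) (x : Γ) :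
    star (σ.leftRegular x) f = star (σ.rightRegular x) f := by
  have h : σ.rightRegular x (star (σ.leftRegular x) f) = f := by
    rw [← apply_rightRegular (star_mem (σ.leftRegular_mem_twistedVN x)),
      ← mem_centralVectors.1 hf]
    exact DFunLike.congr_fun (σ.star_leftRegular_mul x) _
  conv_rhs => rw [← h]
  exact (DFunLike.congr_fun (σ.star_rightRegular_mul x) _).symm

/-- Pairing a central vector with `a δ_e` does not change if `a` is conjugated. -/
theorem inner_conjugate {f : EllTwo Γ} (hf : f ∈ σ.centralVectors) (ha : a ∈ σ.twistedVN)
    (x : Γ) :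
    inner ℂ f ((σ.leftRegular x * a * star (σ.leftRegular x)) (pointMass 1)) =
      inner ℂ f (a (pointMass 1)) := by
  have h : σ.rightRegular x (star (σ.rightRegular x) f) = f := by
    rw [← star_leftRegular_eq_star_rightRegular hf,
      ← apply_rightRegular (star_mem (σ.leftRegular_mem_twistedVN x)),
      ← mem_centralVectors.1 hf]
    exact DFunLike.congr_fun (σ.star_leftRegular_mul x) _
  -- `λ(x) a λ(x)* δ_e = λ(x) ρ(x)* a δ_e`, and the adjoint `ρ(x) λ(x)*` fixes `f`.
  rw [mul_apply_eq_comp, mul_apply_eq_comp,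
    star_leftRegular_pointMass_one, apply_star_rightRegular ha,
    ← ContinuousLinearMap.adjoint_inner_left, ← ContinuousLinearMap.star_eq_adjoint,
    star_leftRegular_eq_star_rightRegular hf, ContinuousLinearMap.star_eq_adjoint,
    ContinuousLinearMap.adjoint_inner_right, ← ContinuousLinearMap.star_eq_adjoint, h]

end TwoCocycle

end

/-! ### Averages of conjugates and vectors of minimal norm -/

noncomputable section

/-- The convex combinations of the conjugates `u x * a * star (u x)` of an operator `a`. -/
def conjugateAverages {H ι : Type*} [NormedAddCommGroup H] [InnerProductSpace ℂ H]
    [CompleteSpace H] (u : ι → H →L[ℂ] H) (a : H →L[ℂ] H) : Set (H →L[ℂ] H) :=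
  convexHull ℝ (Set.range fun x => u x * a * star (u x))

section ConjugateAverages

variable {H ι : Type*} [NormedAddCommGroup H] [InnerProductSpace ℂ H] [CompleteSpace H]
  {u : ι → H →L[ℂ] H} {a b c : H →L[ℂ] H}

theorem conjugate_mem_conjugateAverages (x : ι) : u x * a * star (u x) ∈ conjugateAverages u a :=
  subset_convexHull _ _ ⟨x, rfl⟩

theorem conjugateAverages_convex (hb : b ∈ conjugateAverages u a)
    (hc : c ∈ conjugateAverages u a) {s t : ℝ} (hs : 0 ≤ s) (ht : 0 ≤ t) (hst : s + t = 1) :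
    (s : ℂ) • b + (t : ℂ) • c ∈ conjugateAverages u a := by
  rw [Complex.coe_smul, Complex.coe_smul]
  exact convex_convexHull ℝ _ hb hc hs ht hst

@[elab_as_elim]
theorem conjugateAverages_induction {p : (H →L[ℂ] H) → Prop} (hb : b ∈ conjugateAverages u a)
    (conjugate : ∀ x, p (u x * a * star (u x)))
    (convex : ∀ b c, p b → p c → ∀ s t : ℝ, 0 ≤ s → 0 ≤ t → s + t = 1 →
      p ((s : ℂ) • b + (t : ℂ) • c)) : p b := by
  have h : conjugateAverages u a ⊆ {b | p b} := by
    refine convexHull_min ?_ ?_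
    · rintro _ ⟨x, rfl⟩
      exact conjugate x
    · intro b hb c hc s t hs ht hst
      have := convex b c hb hc s t hs ht hst
      rwa [Complex.coe_smul, Complex.coe_smul] at this
  exact h hb

theorem norm_le_of_mem_conjugateAverages (hu : ∀ x, ‖u x‖ ≤ 1) (hb : b ∈ conjugateAverages u a) :
    ‖b‖ ≤ ‖a‖ := by
  refine conjugateAverages_induction hb (fun x => ?_) fun b c hb hc s t hs ht hst => ?_
  · calc _ ≤ ‖u x‖ * ‖a‖ * ‖star (u x)‖ :=
          (norm_mul_le _ _).trans (by gcongr; exact norm_mul_le _ _)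
      _ ≤ 1 * ‖a‖ * 1 := by
          rw [norm_star]
          gcongr <;> exact hu x
      _ = ‖a‖ := by ring
  · calc _ ≤ ‖(s : ℂ) • b‖ + ‖(t : ℂ) • c‖ := norm_add_le _ _
      _ = s * ‖b‖ + t * ‖c‖ := by
          rw [norm_smul, norm_smul, Complex.norm_of_nonneg hs, Complex.norm_of_nonneg ht]
      _ ≤ s * ‖a‖ + t * ‖a‖ := by gcongr
      _ = ‖a‖ := by rw [← add_mul, hst, one_mul]

/-- The vector of minimal norm in the closure of the averages of a vector is fixed by every
contraction that maps the averages to themselves. -/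
theorem exists_mem_closure_apply_conjugateAverages [Nonempty ι] (v : H) :
    ∃ w ∈ closure ((fun b : H →L[ℂ] H => b v) '' conjugateAverages u a),
      ∀ T : H →L[ℂ] H, ‖T‖ ≤ 1 →
        (∀ b ∈ conjugateAverages u a, ∃ c ∈ conjugateAverages u a, T (b v) = c v) → T w = w := by
  -- The variational characterization of the nearest point in a convex set uses the real inner
  -- product.
  let := InnerProductSpace.rclikeToReal ℂ H
  set S := (fun b : H →L[ℂ] H => b v) '' conjugateAverages u a
  have hne : S.Nonempty := (Set.range_nonempty _).convexHull.image _
  have hconv : Convex ℝ S :=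
    (convex_convexHull ℝ _).is_linear_image ⟨fun _ _ => rfl, fun _ _ => rfl⟩
  obtain ⟨w, hwS, hw⟩ := exists_norm_eq_iInf_of_complete_convex hne.closure
    isClosed_closure.isComplete hconv.closure 0
  rw [norm_eq_iInf_iff_real_inner_le_zero hconv.closure hwS] at hw
  refine ⟨w, hwS, fun T hT hTS => ?_⟩
  have hmem : T w ∈ closure S := by
    refine map_mem_closure T.continuous hwS ?_
    rintro _ ⟨b, hb, rfl⟩
    obtain ⟨c, hc, h⟩ := hTS b hb
    exact ⟨c, hc, h.symm⟩
  have hnorm : ‖T w‖ ≤ ‖w‖ := (T.le_of_opNorm_le hT w).trans_eq (one_mul _)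
  -- Minimality tested against `T w` gives `‖w‖² ≤ Re ⟨w, T w⟩`; with `‖T w‖ ≤ ‖w‖` this forces `‖w
  -- - T w‖² ≤ 0`.
  have h1 := hw _ hmem
  rw [zero_sub, inner_neg_left, inner_sub_right, real_inner_self_eq_norm_sq] at h1
  have h2 := norm_sub_sq_real w (T w)
  have h3 : ‖w - T w‖ ^ 2 ≤ 0 := by nlinarith [norm_nonneg (T w)]
  have h4 : ‖w - T w‖ = 0 := pow_eq_zero_iff two_ne_zero |>.1 (le_antisymm h3 (sq_nonneg _))
  exact (sub_eq_zero.1 (norm_eq_zero.1 h4)).symm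

end ConjugateAverages

/-! ### Averaging in the twisted algebra -/

namespace TwoCocycle

variable {Γ : Type*} [Group Γ] {σ : TwoCocycle Γ} {a b : EllTwo Γ →L[ℂ] EllTwo Γ}

open Filter Topology

/-- A bounded sequence in `vN(Γ, σ)` converging at `δ_e` converges strongly in `vN(Γ, σ)`. -/
theorem exists_strong_limit {b : ℕ → EllTwo Γ →L[ℂ] EllTwo Γ} (hb : ∀ n, b n ∈ σ.twistedVN)
    {C : ℝ} (hC : ∀ n, ‖b n‖ ≤ C) {w : EllTwo Γ}
    (hw : Tendsto (fun n => b n (pointMass 1)) atTop (𝓝 w)) :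
    ∃ c ∈ σ.twistedVN, ‖c‖ ≤ C ∧ ∀ v, Tendsto (fun n => b n v) atTop (𝓝 (c v)) := by
  have hC0 : 0 ≤ C := (norm_nonneg _).trans (hC 0)
  have hspan : ∀ u ∈ Submodule.span ℂ (Set.range (pointMass : Γ → EllTwo Γ)),
      ∃ u', Tendsto (fun n => b n u) atTop (𝓝 u') := by
    intro u hu
    induction hu using Submodule.span_induction with
    | mem u hu =>
      obtain ⟨x, rfl⟩ := hu
      -- Convergence at `δ_e` spreads to every `δ_x`, since `b n δ_x = ρ(x) (b n δ_e)`.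
      refine ⟨σ.rightRegular x w, ?_⟩
      simp only [apply_pointMass (hb _) x]
      exact ((σ.rightRegular x).continuous.tendsto w).comp hw
    | zero => exact ⟨0, by simp⟩
    | add u v _ _ hu hv =>
      obtain ⟨u', hu'⟩ := hu
      obtain ⟨v', hv'⟩ := hv
      exact ⟨u' + v', by simpa using hu'.add hv'⟩
    | smul c u _ hu =>
      obtain ⟨u', hu'⟩ := hu
      exact ⟨c • u', by simpa using hu'.const_smul c⟩
  have hcauchy : ∀ v, CauchySeq fun n => b n v := by
    intro v
    rw [Metric.cauchySeq_iff]
    intro ε hε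
    -- Replacing `v` by `u` costs at most `ε / 4` at each end, leaving `ε / 2` for the middle; `C +
    -- 1` keeps the denominator positive when `C = 0`.
    obtain ⟨u, hu, huv⟩ := Metric.dense_iff.1 dense_span_pointMass v (ε / (4 * (C + 1)))
      (by positivity)
    obtain ⟨u', hu'⟩ := hspan u huv
    obtain ⟨N, hN⟩ := Metric.cauchySeq_iff.1 hu'.cauchySeq (ε / 2) (by positivity)
    refine ⟨N, fun m hm n hn => ?_⟩
    have hd : ∀ n, dist (b n v) (b n u) ≤ ε / 4 := by
      intro n
      rw [dist_eq_norm, ← map_sub]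
      have h1 : ‖v - u‖ ≤ ε / (4 * (C + 1)) := by
        rw [Metric.mem_ball, dist_comm, dist_eq_norm] at hu
        exact hu.le
      calc ‖b n (v - u)‖ ≤ (C + 1) * (ε / (4 * (C + 1))) :=
            (b n).le_of_opNorm_le_of_le ((hC n).trans (by linarith)) h1
        _ = ε / 4 := by field_simp
    have h1 := hd m
    have h2 := hd n
    have h3 := hN m hm n hn
    rw [dist_comm] at h2
    linarith [dist_triangle4 (b m v) (b m u) (b n u) (b n v)]
  choose f hf using fun v => cauchySeq_tendsto_of_complete (hcauchy v)
  refine ⟨continuousLinearMapOfTendsto b (tendsto_pi_nhds.2 hf), ?_, ?_, hf⟩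
  · intro d hd
    ext1 v
    refine tendsto_nhds_unique ((d.continuous.tendsto _).comp (hf v)) ?_
    refine (hf (d v)).congr fun n => ?_
    exact (DFunLike.congr_fun (hb n d hd) v).symm
  · refine ContinuousLinearMap.opNorm_le_bound _ hC0 fun v => ?_
    exact le_of_tendsto (hf v).norm (Eventually.of_forall fun n =>
      (b n).le_of_opNorm_le (hC n) v)

theorem conjugate_mem (ha : a ∈ σ.twistedVN) (x : Γ) :
    σ.leftRegular x * a * star (σ.leftRegular x) ∈ σ.twistedVN :=
  mul_mem (mul_mem (σ.leftRegular_mem_twistedVN x) ha)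
    (star_mem (σ.leftRegular_mem_twistedVN x))

theorem mem_twistedVN_of_mem_conjugateAverages (ha : a ∈ σ.twistedVN)
    (hb : b ∈ conjugateAverages σ.leftRegular a) : b ∈ σ.twistedVN := by
  refine conjugateAverages_induction hb (fun x => ?_) fun b c hb hc s t hs ht hst => ?_
  · exact conjugate_mem ha x
  · exact add_mem (σ.twistedVN.toStarSubalgebra.smul_mem hb _)
      (σ.twistedVN.toStarSubalgebra.smul_mem hc _)

theorem inner_of_mem_conjugateAverages {f : EllTwo Γ} (hf : f ∈ σ.centralVectors)
    (ha : a ∈ σ.twistedVN) (hb : b ∈ conjugateAverages σ.leftRegular a) :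
    inner ℂ f (b (pointMass 1)) = inner ℂ f (a (pointMass 1)) := by
  refine conjugateAverages_induction hb (fun x => ?_) fun b c hb hc s t hs ht hst => ?_
  · exact inner_conjugate hf ha x
  · rw [add_apply, inner_add_right, smul_apply, smul_apply, inner_smul_right, inner_smul_right,
      hb, hc, ← add_mul, ← Complex.ofReal_add, hst, Complex.ofReal_one, one_mul]

theorem conjugate_conjugate (a : EllTwo Γ →L[ℂ] EllTwo Γ) (x y : Γ) :
    σ.leftRegular x * (σ.leftRegular y * a * star (σ.leftRegular y)) * star (σ.leftRegular x) =
      σ.leftRegular (x * y) * a * star (σ.leftRegular (x * y)) := by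
  have hc : (σ x y : ℂ) * star (σ x y : ℂ) = 1 := by
    rw [Complex.star_def, Complex.mul_conj]
    simp
  calc _ = (σ.leftRegular x * σ.leftRegular y) * a *
        star (σ.leftRegular x * σ.leftRegular y) := by
        rw [star_mul]
        simp only [mul_assoc]
    _ = ((σ x y : ℂ) * star (σ x y : ℂ)) •
        (σ.leftRegular (x * y) * a * star (σ.leftRegular (x * y))) := by
        rw [leftRegular_mul, star_smul, mul_smul_comm, smul_mul_assoc, smul_mul_assoc, smul_smul,
          mul_comm]
    _ = _ := by rw [hc, one_smul]

theorem conjugate_average_mem (hb : b ∈ conjugateAverages σ.leftRegular a) (x : Γ) :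
    σ.leftRegular x * b * star (σ.leftRegular x) ∈ conjugateAverages σ.leftRegular a := by
  refine conjugateAverages_induction hb (fun x => ?_) fun b c hb hc s t hs ht hst => ?_
  · rw [conjugate_conjugate]
    exact conjugate_mem_conjugateAverages _
  · rw [mul_add, add_mul, mul_smul_comm, mul_smul_comm, smul_mul_assoc, smul_mul_assoc]
    exact conjugateAverages_convex hb hc hs ht hst

/-- The projection of `a δ_e` to the central vectors is a limit of averages of conjugates. -/
theorem starProjection_mem_closure (ha : a ∈ σ.twistedVN) :
    σ.centralVectors.starProjection (a (pointMass 1)) ∈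
      closure ((fun b : EllTwo Γ →L[ℂ] EllTwo Γ => b (pointMass 1)) ''
        conjugateAverages σ.leftRegular a) := by
  obtain ⟨w, hwS, hw⟩ := exists_mem_closure_apply_conjugateAverages (u := σ.leftRegular) (a := a)
    (pointMass 1)
  -- The contraction `ρ(x)* λ(x)` sends `b δ_e` to `λ(x) b λ(x)* δ_e`, hence maps averages to
  -- averages.
  have hfix : ∀ x, star (σ.rightRegular x) (σ.leftRegular x w) = w := by
    intro x
    refine hw (star (σ.rightRegular x) * σ.leftRegular x) ?_ fun b hb => ?_
    · refine (norm_mul_le _ _).trans (mul_le_one₀ ?_ (norm_nonneg _) (σ.norm_leftRegular_le x))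
      rw [ContinuousLinearMap.star_eq_adjoint, LinearIsometryEquiv.norm_map]
      exact (σ.rightRegularIsometry x).norm_toContinuousLinearMap_le
    · refine ⟨_, conjugate_average_mem hb x, ?_⟩
      have hbM := mem_twistedVN_of_mem_conjugateAverages ha hb
      rw [mul_apply_eq_comp, mul_apply_eq_comp, mul_apply_eq_comp,
        star_leftRegular_pointMass_one, apply_star_rightRegular hbM,
        apply_star_rightRegular (σ.leftRegular_mem_twistedVN x)]
  have hwK : w ∈ σ.centralVectors := by
    refine mem_centralVectors.2 fun x => ?_
    -- By `hfix`, `⟨ρ(x) w, λ(x) w⟩ = ‖w‖²`: equality in Cauchy–Schwarz for two vectors of norm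
    -- `‖w‖`.
    have h1 := norm_sub_sq (𝕜 := ℂ) (σ.leftRegular x w) (σ.rightRegular x w)
    rw [← ContinuousLinearMap.adjoint_inner_left, ← ContinuousLinearMap.star_eq_adjoint, hfix,
      norm_leftRegular_apply, norm_rightRegular_apply, inner_self_eq_norm_sq] at h1
    have h4 : ‖σ.leftRegular x w - σ.rightRegular x w‖ = 0 :=
      pow_eq_zero_iff two_ne_zero |>.1 (h1.trans (by ring))
    exact sub_eq_zero.1 (norm_eq_zero.1 h4)
  rw [Submodule.eq_starProjection_of_mem_of_inner_eq_zero hwK]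
  · exact hwS
  · intro f hf
    have h : closure ((fun b : EllTwo Γ →L[ℂ] EllTwo Γ => b (pointMass 1)) ''
        conjugateAverages σ.leftRegular a) ⊆ {v | inner ℂ f v = inner ℂ f (a (pointMass 1))} := by
      refine closure_minimal ?_ (isClosed_eq (by fun_prop) continuous_const)
      rintro _ ⟨b, hb, rfl⟩
      exact inner_of_mem_conjugateAverages hf ha hb
    rw [← inner_conj_symm, inner_sub_right, h hwS, sub_self, map_zero]

/-- Averages approaching `P (a δ_e)` at `δ_e` are bounded by `‖a‖`, so they converge strongly to
some `z` in `M`. As `z δ_e` is a central vector, `λ(x) z` and `z λ(x)` agree at the separating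
vector `δ_e`. -/
theorem exists_central_average (ha : a ∈ σ.twistedVN) :
    ∃ z ∈ σ.twistedVN.centerVN,
      z (pointMass 1) = σ.centralVectors.starProjection (a (pointMass 1)) ∧ ‖z‖ ≤ ‖a‖ ∧
      ∃ b : ℕ → EllTwo Γ →L[ℂ] EllTwo Γ, (∀ n, b n ∈ conjugateAverages σ.leftRegular a) ∧
        ∀ v, Tendsto (fun n => b n v) atTop (𝓝 (z v)) := by
  obtain ⟨v, hv, hvlim⟩ := mem_closure_iff_seq_limit.1 (starProjection_mem_closure ha)
  choose b hb hbv using hv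
  have hbM : ∀ n, b n ∈ σ.twistedVN := fun n => mem_twistedVN_of_mem_conjugateAverages ha (hb n)
  obtain rfl : (fun n => b n (pointMass 1)) = v := funext hbv
  obtain ⟨z, hzM, hz, hlim⟩ := exists_strong_limit hbM
    (fun n => norm_le_of_mem_conjugateAverages σ.norm_leftRegular_le (hb n)) hvlim
  have hzP := tendsto_nhds_unique (hlim (pointMass 1)) hvlim
  refine ⟨z, ?_, hzP, hz, b, hb, hlim⟩
  refine σ.mem_center_of_commute_leftRegular hzM fun x => ?_
  refine eq_of_apply_pointMass_one_eq (mul_mem (σ.leftRegular_mem_twistedVN x) hzM)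
    (mul_mem hzM (σ.leftRegular_mem_twistedVN x)) ?_
  have hK : z (pointMass 1) ∈ σ.centralVectors := by
    rw [hzP]
    exact Submodule.starProjection_apply_mem _ _
  rw [mul_apply_eq_comp, mul_apply_eq_comp, mem_centralVectors.1 hK,
    ← apply_rightRegular hzM, rightRegular_pointMass_one, leftRegular_pointMass_one]

end TwoCocycle

end

/-! ### The expectation onto the center and its algebraic properties -/

noncomputable section

namespace TwoCocycle

variable {Γ : Type*} [Group Γ] {σ : TwoCocycle Γ} {a b z : EllTwo Γ →L[ℂ] EllTwo Γ}

open Filter Topology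

theorem mem_twistedVN_of_mem_center (hz : z ∈ σ.twistedVN.centerVN) : z ∈ σ.twistedVN :=
  ((VonNeumannAlgebra.mem_centerVN _ _).1 hz).1

theorem center_apply_comm (hz : z ∈ σ.twistedVN.centerVN) (ha : a ∈ σ.twistedVN)
    (f : EllTwo Γ) : z (a f) = a (z f) :=
  (DFunLike.congr_fun (((VonNeumannAlgebra.mem_centerVN _ _).1 hz).2 a ha) f).symm

/-- The central operator obtained from `a` by averaging over conjugates. -/
def centralPart (ha : a ∈ σ.twistedVN) : EllTwo Γ →L[ℂ] EllTwo Γ :=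
  (exists_central_average ha).choose

theorem centralPart_mem_center (ha : a ∈ σ.twistedVN) : centralPart ha ∈ σ.twistedVN.centerVN :=
  (exists_central_average ha).choose_spec.1

theorem centralPart_apply_pointMass_one (ha : a ∈ σ.twistedVN) :
    centralPart ha (pointMass 1) = σ.centralVectors.starProjection (a (pointMass 1)) :=
  (exists_central_average ha).choose_spec.2.1

theorem norm_centralPart_le (ha : a ∈ σ.twistedVN) : ‖centralPart ha‖ ≤ ‖a‖ :=
  (exists_central_average ha).choose_spec.2.2.1

theorem centralPart_add (ha : a ∈ σ.twistedVN) (hb : b ∈ σ.twistedVN) (hab : a + b ∈ σ.twistedVN) :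
    centralPart hab = centralPart ha + centralPart hb := by
  refine eq_of_apply_pointMass_one_eq (mem_twistedVN_of_mem_center (centralPart_mem_center hab))
    (mem_twistedVN_of_mem_center
      (add_mem (centralPart_mem_center ha) (centralPart_mem_center hb))) ?_
  rw [add_apply, centralPart_apply_pointMass_one, centralPart_apply_pointMass_one,
    centralPart_apply_pointMass_one, add_apply, map_add]

theorem centralPart_smul (c : ℂ) (ha : a ∈ σ.twistedVN) (hca : c • a ∈ σ.twistedVN) :
    centralPart hca = c • centralPart ha := by
  refine eq_of_apply_pointMass_one_eq (mem_twistedVN_of_mem_center (centralPart_mem_center hca))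
    (mem_twistedVN_of_mem_center
      (σ.twistedVN.centerVN.toStarSubalgebra.smul_mem (centralPart_mem_center ha) c)) ?_
  rw [smul_apply, centralPart_apply_pointMass_one, centralPart_apply_pointMass_one,
    smul_apply, map_smul]

variable (σ) in
/-- The map `E : vN(Γ, σ) → Z(vN(Γ, σ))` with `E(a) δ_e = P (a δ_e)`, where `P` is the
projection onto the central vectors, as a linear map. -/
def centerExpectationLinear :
    σ.twistedVN.toStarSubalgebra →ₗ[ℂ] σ.twistedVN.centerVN.toStarSubalgebra where
  toFun a := ⟨centralPart a.2, centralPart_mem_center a.2⟩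
  map_add' a b := Subtype.ext (centralPart_add a.2 b.2 (a + b).2)
  map_smul' c a := Subtype.ext (centralPart_smul c a.2 (c • a).2)

theorem norm_centerExpectationLinear_le (a : σ.twistedVN.toStarSubalgebra) :
    ‖σ.centerExpectationLinear a‖ ≤ 1 * ‖a‖ :=
  (norm_centralPart_le a.2).trans_eq (one_mul _).symm

variable (σ) in
/-- The map `E : vN(Γ, σ) → Z(vN(Γ, σ))` with `E(a) δ_e = P (a δ_e)`, where `P` is the
projection onto the central vectors. -/
def centerExpectation :
    σ.twistedVN.toStarSubalgebra →L[ℂ] σ.twistedVN.centerVN.toStarSubalgebra :=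
  σ.centerExpectationLinear.mkContinuous 1 norm_centerExpectationLinear_le

theorem centerExpectation_mem_center (a : σ.twistedVN.toStarSubalgebra) :
    (σ.centerExpectation a : EllTwo Γ →L[ℂ] EllTwo Γ) ∈ σ.twistedVN.centerVN :=
  (σ.centerExpectation a).2

theorem centerExpectation_mem (a : σ.twistedVN.toStarSubalgebra) :
    (σ.centerExpectation a : EllTwo Γ →L[ℂ] EllTwo Γ) ∈ σ.twistedVN :=
  mem_twistedVN_of_mem_center (centerExpectation_mem_center a)

theorem centerExpectation_apply_pointMass_one (a : σ.twistedVN.toStarSubalgebra) :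
    (σ.centerExpectation a : EllTwo Γ →L[ℂ] EllTwo Γ) (pointMass 1) =
      σ.centralVectors.starProjection ((a : EllTwo Γ →L[ℂ] EllTwo Γ) (pointMass 1)) :=
  (exists_central_average a.2).choose_spec.2.1

theorem exists_averages_tendsto_centerExpectation (a : σ.twistedVN.toStarSubalgebra) :
    ∃ b : ℕ → EllTwo Γ →L[ℂ] EllTwo Γ,
      (∀ n, b n ∈ conjugateAverages σ.leftRegular (a : EllTwo Γ →L[ℂ] EllTwo Γ)) ∧
        ∀ v, Tendsto (fun n => b n v) atTop
          (𝓝 ((σ.centerExpectation a : EllTwo Γ →L[ℂ] EllTwo Γ) v)) :=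
  (exists_central_average a.2).choose_spec.2.2.2

theorem center_apply_mem_centralVectors (hz : z ∈ σ.twistedVN.centerVN) {f : EllTwo Γ}
    (hf : f ∈ σ.centralVectors) : z f ∈ σ.centralVectors := by
  refine mem_centralVectors.2 fun x => ?_
  rw [← center_apply_comm hz (σ.leftRegular_mem_twistedVN x), mem_centralVectors.1 hf,
    apply_rightRegular (mem_twistedVN_of_mem_center hz)]

/-- The center is closed under adjoints and leaves the central vectors invariant, so that subspace
reduces each central operator. -/
theorem starProjection_center_apply (hz : z ∈ σ.twistedVN.centerVN) (f : EllTwo Γ) :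
    σ.centralVectors.starProjection (z f) = z (σ.centralVectors.starProjection f) := by
  refine Submodule.eq_starProjection_of_mem_of_inner_eq_zero
    (center_apply_mem_centralVectors hz (Submodule.starProjection_apply_mem _ _)) fun w hw => ?_
  rw [← map_sub, ← ContinuousLinearMap.adjoint_inner_right]
  exact Submodule.starProjection_inner_eq_zero _ _
    (center_apply_mem_centralVectors (star_mem hz) hw)

theorem inner_starProjection_centralVectors {f : EllTwo Γ} (hf : f ∈ σ.centralVectors)
    (g : EllTwo Γ) : inner ℂ f (σ.centralVectors.starProjection g) = inner ℂ f g := by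
  rw [← Submodule.inner_starProjection_left_eq_right, Submodule.starProjection_eq_self_iff.2 hf]

theorem centerExpectation_of_mem_center (a : σ.twistedVN.toStarSubalgebra)
    (ha : (a : EllTwo Γ →L[ℂ] EllTwo Γ) ∈ σ.twistedVN.centerVN) :
    (σ.centerExpectation a : EllTwo Γ →L[ℂ] EllTwo Γ) = a := by
  refine eq_of_apply_pointMass_one_eq (centerExpectation_mem a) a.2 ?_
  rw [centerExpectation_apply_pointMass_one, Submodule.starProjection_eq_self_iff]
  exact apply_pointMass_one_mem_centralVectors ha

theorem centerExpectation_center_mul (a b : σ.twistedVN.toStarSubalgebra)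
    (hb : (b : EllTwo Γ →L[ℂ] EllTwo Γ) ∈ σ.twistedVN.centerVN) :
    (σ.centerExpectation (b * a) : EllTwo Γ →L[ℂ] EllTwo Γ) =
      (b : EllTwo Γ →L[ℂ] EllTwo Γ) * (σ.centerExpectation a : EllTwo Γ →L[ℂ] EllTwo Γ) := by
  refine eq_of_apply_pointMass_one_eq (centerExpectation_mem _)
    (mul_mem b.2 (centerExpectation_mem a)) ?_
  rw [centerExpectation_apply_pointMass_one, mul_apply_eq_comp,
    centerExpectation_apply_pointMass_one, ← starProjection_center_apply hb]
  rfl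

variable (σ) in
theorem pointMass_one_mem_centralVectors : pointMass 1 ∈ σ.centralVectors :=
  mem_centralVectors.2 fun x => by
    rw [leftRegular_pointMass_one, rightRegular_pointMass_one]

/-- Since `δ_e` is a central vector, `⟨δ_e, E(a* a) δ_e⟩ = ‖a δ_e‖²`, and `δ_e` is separating. -/
theorem centerExpectation_faithful (a : σ.twistedVN.toStarSubalgebra)
    (h : σ.centerExpectation (star a * a) = 0) : a = 0 := by
  have h1 := centerExpectation_apply_pointMass_one (star a * a)
  have h2 := inner_starProjection_centralVectors (σ.pointMass_one_mem_centralVectors)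
    (((star a * a : σ.twistedVN.toStarSubalgebra) : EllTwo Γ →L[ℂ] EllTwo Γ) (pointMass 1))
  rw [← h1, h, ZeroMemClass.coe_zero, zero_apply, inner_zero_right] at h2
  have h3 : inner ℂ ((a : EllTwo Γ →L[ℂ] EllTwo Γ) (pointMass 1))
      ((a : EllTwo Γ →L[ℂ] EllTwo Γ) (pointMass 1)) = 0 := by
    rw [← ContinuousLinearMap.adjoint_inner_right]
    exact h2.symm
  refine Subtype.ext (eq_of_apply_pointMass_one_eq (σ := σ) a.2 (zero_mem _) ?_)
  exact inner_self_eq_zero.1 h3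

/-- The vectors `z δ_e` with `z` in the center are dense in the central vectors. -/
theorem mem_closure_center_apply {f : EllTwo Γ} (hf : f ∈ σ.centralVectors) :
    f ∈ closure ((fun z : EllTwo Γ →L[ℂ] EllTwo Γ => z (pointMass 1)) ''
      (σ.twistedVN.centerVN : Set (EllTwo Γ →L[ℂ] EllTwo Γ))) := by
  rw [← Submodule.starProjection_eq_self_iff.2 hf]
  -- A finitely supported vector is `a δ_e` with `a` in `M`, and its projection is `E(a) δ_e` with
  -- `E(a)` central.
  refine map_mem_closure (ContinuousLinearMap.continuous _) (dense_span_pointMass f) ?_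
  intro u hu
  have h : ∃ a ∈ σ.twistedVN, a (pointMass 1) = u := by
    induction hu using Submodule.span_induction with
    | mem u hu =>
      obtain ⟨x, rfl⟩ := hu
      exact ⟨_, σ.leftRegular_mem_twistedVN x, σ.leftRegular_pointMass_one x⟩
    | zero => exact ⟨0, zero_mem _, rfl⟩
    | add u v _ _ hu hv =>
      obtain ⟨a, ha, rfl⟩ := hu
      obtain ⟨b, hb, rfl⟩ := hv
      exact ⟨a + b, add_mem ha hb, rfl⟩
    | smul c u _ hu =>
      obtain ⟨a, ha, rfl⟩ := hu
      exact ⟨c • a, σ.twistedVN.toStarSubalgebra.smul_mem ha c, rfl⟩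
  obtain ⟨a, ha, rfl⟩ := h
  exact ⟨_, centerExpectation_mem_center ⟨a, ha⟩, centerExpectation_apply_pointMass_one ⟨a, ha⟩⟩

/-- By density take `f = z δ_e` with `z` central; moving `z*` across reduces the claim to traciality
of the state for `z* a` and `b`. -/
theorem inner_centralVectors_mul_comm {f : EllTwo Γ} (hf : f ∈ σ.centralVectors)
    (ha : a ∈ σ.twistedVN) (hb : b ∈ σ.twistedVN) :
    inner ℂ f ((a * b) (pointMass 1)) = inner ℂ f ((b * a) (pointMass 1)) := by
  have h : IsClosed {f : EllTwo Γ | inner ℂ f ((a * b) (pointMass 1)) =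
      inner ℂ f ((b * a) (pointMass 1))} := isClosed_eq (by fun_prop) (by fun_prop)
  refine closure_minimal ?_ h (mem_closure_center_apply hf)
  rintro _ ⟨z, hz, rfl⟩
  have hz' : star z ∈ σ.twistedVN.centerVN := star_mem hz
  have hzM := mem_twistedVN_of_mem_center hz'
  change inner ℂ (z _) _ = inner ℂ (z _) _
  rw [← ContinuousLinearMap.adjoint_inner_right, ← ContinuousLinearMap.adjoint_inner_right,
    ← ContinuousLinearMap.star_eq_adjoint]
  have h1 := inner_mul_comm (mul_mem hzM ha) hb
  rw [mul_apply_eq_comp, mul_apply_eq_comp, mul_apply_eq_comp, mul_apply_eq_comp,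
    ← center_apply_comm hz' hb] at h1
  exact h1

theorem centerExpectation_mul_comm (a b : σ.twistedVN.toStarSubalgebra) :
    σ.centerExpectation (a * b) = σ.centerExpectation (b * a) := by
  refine Subtype.ext (eq_of_apply_pointMass_one_eq (centerExpectation_mem _)
    (centerExpectation_mem _) ?_)
  rw [centerExpectation_apply_pointMass_one, centerExpectation_apply_pointMass_one]
  refine Submodule.eq_starProjection_of_mem_of_inner_eq_zero
    (Submodule.starProjection_apply_mem _ _) fun w hw => ?_
  rw [← inner_conj_symm, inner_sub_right, inner_starProjection_centralVectors hw]
  have h := inner_centralVectors_mul_comm hw a.2 b.2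
  rw [map_eq_zero, sub_eq_zero]
  exact h

/-- The bridge to normality. For `f = z δ_e` with `z` central, both sides become pairings of the
central vector `z* z δ_e`, with `P (a δ_e)` and with `a δ_e`; density gives the rest. -/
theorem inner_centerExpectation_apply {f : EllTwo Γ} (hf : f ∈ σ.centralVectors)
    (a : σ.twistedVN.toStarSubalgebra) :
    inner ℂ f ((σ.centerExpectation a : EllTwo Γ →L[ℂ] EllTwo Γ) f) =
      inner ℂ f ((a : EllTwo Γ →L[ℂ] EllTwo Γ) f) := by
  have h : IsClosed {f : EllTwo Γ |
      inner ℂ f ((σ.centerExpectation a : EllTwo Γ →L[ℂ] EllTwo Γ) f) =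
        inner ℂ f ((a : EllTwo Γ →L[ℂ] EllTwo Γ) f)} := isClosed_eq (by fun_prop) (by fun_prop)
  refine closure_minimal ?_ h (mem_closure_center_apply hf)
  rintro _ ⟨z, hz, rfl⟩
  change inner ℂ (z _) _ = inner ℂ (z _) _
  have hz' : star z ∈ σ.twistedVN.centerVN := star_mem hz
  rw [← center_apply_comm hz (centerExpectation_mem a), ← center_apply_comm hz a.2,
    ← ContinuousLinearMap.adjoint_inner_left z, ← ContinuousLinearMap.adjoint_inner_left z,
    centerExpectation_apply_pointMass_one, inner_starProjection_centralVectors]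
  exact center_apply_mem_centralVectors hz' (apply_pointMass_one_mem_centralVectors hz)

end TwoCocycle

end

/-! ### Amplification to sequences, and a polar decomposition -/

noncomputable section

open Filter Topology

namespace VonNeumannAlgebra

variable {H : Type*} [NormedAddCommGroup H] [InnerProductSpace ℂ H]

/-- The diagonal action of an operator on square-summable sequences. -/
def amplify (a : H →L[ℂ] H) :
    lp (fun _ : ℕ => H) 2 →L[ℂ] lp (fun _ : ℕ => H) 2 :=
  lp.mapCLM 2 (fun _ => a) (norm_nonneg a) fun _ => le_rfl

theorem amplify_apply (a : H →L[ℂ] H) (ξ : lp (fun _ : ℕ => H) 2) (n : ℕ) :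
    amplify a ξ n = a (ξ n) := rfl

theorem inner_amplify (a : H →L[ℂ] H) (ξ η : lp (fun _ : ℕ => H) 2) :
    inner ℂ η (amplify a ξ) = ∑' n, inner ℂ (η n) (a (ξ n)) :=
  lp.inner_eq_tsum _ _

theorem inner_amplify_star [CompleteSpace H] (a : H →L[ℂ] H) (ξ η : lp (fun _ : ℕ => H) 2) :
    inner ℂ (amplify (star a) η) ξ = inner ℂ η (amplify a ξ) := by
  rw [inner_amplify, lp.inner_eq_tsum]
  exact tsum_congr fun n => ContinuousLinearMap.adjoint_inner_left a _ _

/-- The orbit map `a ↦ (a ⊗ 1) ξ` on square-summable sequences. -/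
def amplifyOrbit (ξ : lp (fun _ : ℕ => H) 2) : (H →L[ℂ] H) →ₗ[ℂ] lp (fun _ : ℕ => H) 2 where
  toFun a := amplify a ξ
  map_add' _ _ := rfl
  map_smul' _ _ := rfl

/-- The sequence `v, ξ₀, ξ₁, …`. -/
def cons (v : H) (ξ : lp (fun _ : ℕ => H) 2) : lp (fun _ : ℕ => H) 2 :=
  ⟨fun n => Nat.casesOn n v fun k => ξ k, by
    have h := lp.memℓp ξ
    rw [memℓp_gen_iff (by norm_num)] at h
    exact memℓp_gen ((summable_nat_add_iff 1).1 h)⟩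

theorem inner_amplify_cons (a : H →L[ℂ] H) (v : H) (ξ : lp (fun _ : ℕ => H) 2) :
    inner ℂ (cons v ξ) (amplify a (cons v ξ)) =
      inner ℂ v (a v) + inner ℂ ξ (amplify a ξ) := by
  rw [inner_amplify a ξ, lp.inner_eq_tsum,
    (lp.summable_inner (𝕜 := ℂ) (cons v ξ) (amplify a (cons v ξ))).tsum_eq_zero_add]
  rfl

/-- A uniformly bounded, strongly convergent sequence converges ultraweakly. -/
theorem tendsto_inner_amplify {b : ℕ → H →L[ℂ] H} {c : H →L[ℂ] H} {C : ℝ}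
    (hC : ∀ n, ‖b n‖ ≤ C) (h : ∀ v, Tendsto (fun n => b n v) atTop (𝓝 (c v)))
    (ξ η : lp (fun _ : ℕ => H) 2) :
    Tendsto (fun n => inner ℂ η (amplify (b n) ξ)) atTop (𝓝 (inner ℂ η (amplify c ξ))) := by
  simp only [inner_amplify]
  have hs : Summable fun n => ‖η n‖ * ‖ξ n‖ := by
    have h1 := lp.memℓp ξ
    have h2 := lp.memℓp η
    rw [memℓp_gen_iff (by norm_num)] at h1 h2
    refine (h2.add h1).of_nonneg_of_le (fun n => by positivity) fun n => ?_
    have e : (2 : ℝ≥0∞).toReal = (2 : ℕ) := by norm_num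
    rw [e, Real.rpow_natCast, Real.rpow_natCast]
    nlinarith [sq_nonneg (‖η n‖ - ‖ξ n‖), sq_nonneg (‖η n‖), sq_nonneg (‖ξ n‖)]
  refine tendsto_tsum_of_dominated_convergence (hs.mul_left C)
    (fun n => tendsto_const_nhds.inner (h (ξ n))) (Eventually.of_forall fun n k => ?_)
  calc ‖inner ℂ (η k) (b n (ξ k))‖ ≤ ‖η k‖ * ‖b n (ξ k)‖ := norm_inner_le_norm _ _
    _ ≤ ‖η k‖ * (C * ‖ξ k‖) := by
        gcongr
        exact (b n).le_of_opNorm_le (hC n) _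
    _ = C * (‖η k‖ * ‖ξ k‖) := by ring

end VonNeumannAlgebra

/-- If `T` is injective, then any `ξ ∈ L` is carried to a vector `ζ` by the
partial isometry of the polar decomposition of `T`, which intertwines the operators commuting
with `T`. -/
theorem exists_polar_vector {L H : Type*} [NormedAddCommGroup L] [InnerProductSpace ℂ L]
    [CompleteSpace L] [NormedAddCommGroup H] [InnerProductSpace ℂ H] [CompleteSpace H]
    (T : L →L[ℂ] H) (hT : ∀ l, T l = 0 → l = 0) (ξ : L) :
    ∃ ζ : H, (∀ U : H →L[ℂ] H, (∀ l, U (T l) = 0) → U ζ = 0) ∧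
      ∀ (z : H →L[ℂ] H) (y : L → L), (∀ l, z (T l) = T (y l)) → Continuous y →
        (∀ l, ∃ l', star z (T l) = T l' ∧ ∀ m, inner ℂ l' m = inner ℂ l (y m)) →
        inner ℂ ζ (z ζ) = inner ℂ ξ (y ξ) := by
  -- With `B = (T T*)^{1/2}`, the map `S k ↦ B k` is isometric on the range of `S`, which is dense
  -- because `T` is injective. The vector `ζ` is the image of `ξ` under its extension.
  set S := ContinuousLinearMap.adjoint T with hS
  set A : H →L[ℂ] H := T ∘L S
  have hA0 : 0 ≤ A := (ContinuousLinearMap.nonneg_iff_isPositive A).2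
    (ContinuousLinearMap.isPositive_self_comp_adjoint T)
  set B := CFC.sqrt A
  have hBB : B * B = A := CFC.sqrt_mul_sqrt_self A hA0
  have hBsa : star B = B := (IsSelfAdjoint.of_nonneg (CFC.sqrt_nonneg A)).star_eq
  have hBinner : ∀ u v, inner ℂ (B u) v = inner ℂ u (B v) := by
    intro u v
    conv_rhs => rw [← hBsa]
    rw [ContinuousLinearMap.star_eq_adjoint, ContinuousLinearMap.adjoint_inner_right]
  have hBA : ∀ v, B (B v) = T (S v) := fun v => DFunLike.congr_fun hBB v
  have hnorm : ∀ k, ‖B k‖ = ‖S k‖ := by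
    intro k
    have h : inner ℂ (B k) (B k) = inner ℂ (S k) (S k) := by
      rw [hBinner, hBA, hS, ContinuousLinearMap.adjoint_inner_left]
    rw [inner_self_eq_norm_sq_to_K, inner_self_eq_norm_sq_to_K] at h
    have h' : ‖B k‖ ^ 2 = ‖S k‖ ^ 2 := by exact_mod_cast h
    exact (sq_eq_sq₀ (norm_nonneg _) (norm_nonneg _)).1 h'
  have hdense : ξ ∈ closure (Set.range S) := by
    have h1 : S.rangeᗮ = ⊥ := by
      rw [ContinuousLinearMap.orthogonal_range, hS, ContinuousLinearMap.adjoint_adjoint]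
      exact (Submodule.eq_bot_iff _).2 fun l hl => hT l hl
    have h2 := Submodule.topologicalClosure_eq_top_iff.2 h1
    have h3 : ξ ∈ S.range.topologicalClosure := h2 ▸ Submodule.mem_top
    exact h3
  obtain ⟨s, hs, hlim⟩ := mem_closure_iff_seq_limit.1 hdense
  choose k hk using hs
  obtain rfl : (fun n => S (k n)) = s := funext hk
  have hcauchy : CauchySeq fun n => B (k n) := by
    rw [Metric.cauchySeq_iff]
    intro ε hε
    obtain ⟨N, hN⟩ := Metric.cauchySeq_iff.1 hlim.cauchySeq ε hε
    refine ⟨N, fun m hm n hn => ?_⟩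
    have := hN m hm n hn
    rwa [dist_eq_norm, ← map_sub, ← hnorm, map_sub, ← dist_eq_norm] at this
  obtain ⟨ζ, hζ⟩ := cauchySeq_tendsto_of_complete hcauchy
  refine ⟨ζ, fun U hU => ?_, fun z y hzy hy hz => ?_⟩
  · have hUA : U * A = 0 := by
      ext v
      exact hU (S v)
    have hUB : U * B = 0 := by
      rw [← CStarRing.mul_star_self_eq_zero_iff, star_mul, hBsa, mul_assoc, ← mul_assoc B, hBB,
        ← mul_assoc, hUA, zero_mul]
    refine tendsto_nhds_unique ((U.continuous.tendsto ζ).comp hζ) ?_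
    refine tendsto_const_nhds.congr fun n => ?_
    exact (DFunLike.congr_fun hUB (k n)).symm
  · have hSz : ∀ v, S (z v) = y (S v) := by
      intro v
      refine ext_inner_left ℂ fun l => ?_
      obtain ⟨l', hl', hin⟩ := hz l
      rw [hS, ContinuousLinearMap.adjoint_inner_right, ← ContinuousLinearMap.adjoint_inner_left z,
        ← ContinuousLinearMap.star_eq_adjoint, hl', ← ContinuousLinearMap.adjoint_inner_right,
        ← hS, hin]
    -- `z` commutes with `T T*`, hence with its square root by functional calculus.
    have hcomm : Commute A z := by
      ext v
      change T (S (z v)) = z (T (S v))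
      rw [hSz, hzy]
    have hBz : ∀ v, B (z v) = z (B v) := fun v =>
      DFunLike.congr_fun (hcomm.cfcₙ_nnreal NNReal.sqrt) v
    have heq : ∀ n, inner ℂ (B (k n)) (z (B (k n))) = inner ℂ (S (k n)) (y (S (k n))) := by
      intro n
      rw [hBinner, hBz, hBA, hzy, hS, ContinuousLinearMap.adjoint_inner_left]
    refine tendsto_nhds_unique (hζ.inner ((z.continuous.tendsto ζ).comp hζ)) ?_
    refine (hlim.inner ((hy.tendsto ξ).comp hlim)).congr fun n => ?_
    exact (heq n).symm

end

/-! ### Normality of the expectation -/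

noncomputable section

open Filter Topology VonNeumannAlgebra

namespace VonNeumannAlgebra

variable {H : Type*} [NormedAddCommGroup H] [InnerProductSpace ℂ H]

theorem inner_amplify_single (a : H →L[ℂ] H) (u v : H) :
    inner ℂ (lp.single 2 0 u) (amplify a (lp.single 2 0 v)) = inner ℂ u (a v) := by
  rw [lp.inner_single_left, amplify_apply, lp.single_apply_self]

theorem inner_amplify_polarization (a : H →L[ℂ] H) (ξ η : lp (fun _ : ℕ => H) 2) :
    inner ℂ η (amplify a ξ) =
      (inner ℂ (ξ + η) (amplify a (ξ + η)) - inner ℂ (ξ - η) (amplify a (ξ - η)) -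
        Complex.I * inner ℂ (η + Complex.I • ξ) (amplify a (η + Complex.I • ξ)) +
        Complex.I * inner ℂ (η - Complex.I • ξ) (amplify a (η - Complex.I • ξ))) / 4 := by
  simp only [map_add, map_sub, map_smul, inner_add_left, inner_add_right, inner_sub_left,
    inner_sub_right, inner_smul_left, inner_smul_right, Complex.conj_I]
  linear_combination (1 / 2 * inner ℂ η (amplify a ξ) - 1 / 2 * inner ℂ ξ (amplify a η)) *
    Complex.I_sq

theorem continuous_inner_amplify (ξ η : lp (fun _ : ℕ => H) 2) :
    @Continuous _ _ (ultraweakTopology H) _ fun a : H →L[ℂ] H => inner ℂ η (amplify a ξ) := by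
  simp only [inner_amplify]
  exact continuous_iInf_dom (i := ξ) (continuous_iInf_dom (i := η) continuous_induced_dom)

theorem continuous_ultraweak_rng {X : Type*} [TopologicalSpace X] {f : X → H →L[ℂ] H}
    (h : ∀ ξ η, Continuous fun x => inner ℂ η (amplify (f x) ξ)) :
    @Continuous _ _ _ (ultraweakTopology H) f := by
  simp only [inner_amplify] at h
  exact continuous_iInf_rng.2 fun ξ => continuous_iInf_rng.2 fun η =>
    continuous_induced_rng.2 (h ξ η)

end VonNeumannAlgebra

namespace TwoCocycle

variable {Γ : Type*} [Group Γ] {σ : TwoCocycle Γ}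

variable (σ) in
/-- The closed cyclic subspace generated by `ξ` under the amplified center. -/
def cyclicSubspace (ξ : lp (fun _ : ℕ => EllTwo Γ) 2) :
    Submodule ℂ (lp (fun _ : ℕ => EllTwo Γ) 2) :=
  (σ.twistedVN.centerVN.toSubalgebra.toSubmodule.map (amplifyOrbit ξ)).topologicalClosure

instance (ξ : lp (fun _ : ℕ => EllTwo Γ) 2) : CompleteSpace (σ.cyclicSubspace ξ) :=
  (Submodule.isClosed_topologicalClosure _).completeSpace_coe

theorem amplify_mem_cyclicSubspace {ξ : lp (fun _ : ℕ => EllTwo Γ) 2}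
    {z : EllTwo Γ →L[ℂ] EllTwo Γ} (hz : z ∈ σ.twistedVN.centerVN) :
    amplify z ξ ∈ σ.cyclicSubspace ξ :=
  Submodule.le_topologicalClosure _ ⟨z, hz, rfl⟩

theorem cyclicSubspace_induction {ξ : lp (fun _ : ℕ => EllTwo Γ) 2}
    {p : lp (fun _ : ℕ => EllTwo Γ) 2 → Prop} (hp : IsClosed {l | p l})
    (h : ∀ z ∈ σ.twistedVN.centerVN, p (amplify z ξ)) {l : lp (fun _ : ℕ => EllTwo Γ) 2}
    (hl : l ∈ σ.cyclicSubspace ξ) : p l := by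
  refine closure_minimal ?_ hp hl
  rintro _ ⟨z, hz, rfl⟩
  exact h z hz

theorem amplify_mem_cyclicSubspace_of_mem {ξ l : lp (fun _ : ℕ => EllTwo Γ) 2}
    {z : EllTwo Γ →L[ℂ] EllTwo Γ} (hz : z ∈ σ.twistedVN.centerVN)
    (hl : l ∈ σ.cyclicSubspace ξ) : amplify z l ∈ σ.cyclicSubspace ξ := by
  refine cyclicSubspace_induction (p := fun l => amplify z l ∈ σ.cyclicSubspace ξ)
    ((Submodule.isClosed_topologicalClosure _).preimage (amplify z).continuous) ?_ hl
  intro y hy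
  exact amplify_mem_cyclicSubspace (mul_mem hz hy)

/-- For `l = (z ⊗ 1) ξ` the entry is `⟨z* δ_x, ξ n⟩`, and `‖z* δ_x‖ = ‖z* δ_e‖ = ‖z δ_e‖ = ‖l 0‖` by
traciality. Hence evaluation at coordinate `0` is injective on the cyclic subspace, as the polar
decomposition requires. -/
theorem norm_apply_apply_le {ξ l : lp (fun _ : ℕ => EllTwo Γ) 2}
    (h0 : ξ 0 = pointMass 1) (hl : l ∈ σ.cyclicSubspace ξ) (n : ℕ) (x : Γ) :
    ‖l n x‖ ≤ ‖l 0‖ * ‖ξ‖ := by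
  have hev : ∀ n, Continuous fun l : lp (fun _ : ℕ => EllTwo Γ) 2 => l n :=
    fun n => (lp.evalCLM ℂ (fun _ : ℕ => EllTwo Γ) 2 n).continuous
  refine cyclicSubspace_induction (p := fun l => ‖l n x‖ ≤ ‖l 0‖ * ‖ξ‖) ?_ ?_ hl
  · simp only [← inner_pointMass]
    exact isClosed_le (continuous_const.inner (hev n)).norm ((hev 0).norm.mul continuous_const)
  · intro z hz
    have hzM := mem_twistedVN_of_mem_center hz
    rw [amplify_apply, amplify_apply, h0, ← inner_pointMass,
      ← ContinuousLinearMap.adjoint_inner_left, ← ContinuousLinearMap.star_eq_adjoint,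
      apply_pointMass (star_mem hzM)]
    refine (norm_inner_le_norm _ _).trans ?_
    rw [norm_rightRegular_apply, norm_star_apply_pointMass_one hzM]
    gcongr
    exact lp.norm_apply_le_norm two_ne_zero ξ n

/-- Every normal positive functional on the center, plus the canonical trace, is implemented by a
central vector. -/
theorem exists_central_vector (ξ : lp (fun _ : ℕ => EllTwo Γ) 2) :
    ∃ ζ ∈ σ.centralVectors, ∀ z ∈ σ.twistedVN.centerVN,
      inner ℂ ζ (z ζ) = inner ℂ (pointMass 1) (z (pointMass 1)) + inner ℂ ξ (amplify z ξ) := by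
  -- Prepending `δ_e` makes evaluation at `0` injective on the cyclic subspace, at the price of the
  -- extra trace term. This evaluation takes values in the central vectors, so `ζ` is central.
  set ξ' := cons (pointMass 1) ξ
  have h0 : ξ' 0 = pointMass 1 := rfl
  set ev := lp.evalCLM ℂ (fun _ : ℕ => EllTwo Γ) 2 0
  obtain ⟨ζ, hζ, h⟩ := exists_polar_vector (ev ∘L (σ.cyclicSubspace ξ').subtypeL)
    (fun l hl => by
      have hl0 : l.1 0 = 0 := hl
      refine Subtype.ext (lp.ext (funext fun n => lp.ext (funext fun x => ?_)))
      have h := norm_apply_apply_le h0 l.2 n x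
      rw [hl0, norm_zero, zero_mul] at h
      exact norm_le_zero_iff.1 h)
    ⟨ξ', amplify_mem_cyclicSubspace (z := 1) (one_mem _)⟩
  refine ⟨ζ, mem_centralVectors.2 fun x => ?_, fun z hz => ?_⟩
  · refine sub_eq_zero.1 (hζ (σ.leftRegular x - σ.rightRegular x) fun l => ?_)
    have hK : l.1 0 ∈ σ.centralVectors := by
      refine cyclicSubspace_induction (p := fun l => l 0 ∈ σ.centralVectors)
        (σ.isClosed_centralVectors.preimage ev.continuous) ?_ l.2
      intro z hz
      rw [amplify_apply, h0]
      exact apply_pointMass_one_mem_centralVectors hz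
    exact sub_eq_zero.2 (mem_centralVectors.1 hK x)
  · rw [← inner_amplify_cons]
    refine h z (fun l => ⟨amplify z l.1, amplify_mem_cyclicSubspace_of_mem hz l.2⟩)
      (fun l => rfl) ?_ fun l => ?_
    · exact ((amplify z).continuous.comp continuous_subtype_val).subtype_mk _
    · have hz' : star z ∈ σ.twistedVN.centerVN := star_mem hz
      exact ⟨⟨amplify (star z) l.1, amplify_mem_cyclicSubspace_of_mem hz' l.2⟩, rfl,
        fun m => inner_amplify_star z m.1 l.1⟩

/-- By polarization only the diagonal case matters; there the functional of `E(a)` equals `⟨ζ, a ζ⟩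
- ⟨δ_e, a δ_e⟩` for a central vector `ζ`. -/
theorem continuous_inner_amplify_centerExpectation {X : Type*} [TopologicalSpace X]
    {g : X → σ.twistedVN.toStarSubalgebra}
    (hg : ∀ ξ η, Continuous fun x => inner ℂ η (amplify (g x : EllTwo Γ →L[ℂ] EllTwo Γ) ξ))
    (ξ η : lp (fun _ : ℕ => EllTwo Γ) 2) :
    Continuous fun x =>
      inner ℂ η (amplify (σ.centerExpectation (g x) : EllTwo Γ →L[ℂ] EllTwo Γ) ξ) := by
  have hvec : ∀ v, Continuous fun x => inner ℂ v ((g x : EllTwo Γ →L[ℂ] EllTwo Γ) v) := by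
    intro v
    have h := hg (lp.single 2 0 v) (lp.single 2 0 v)
    simpa only [inner_amplify_single] using h
  have hdiag : ∀ ξ, Continuous fun x =>
      inner ℂ ξ (amplify (σ.centerExpectation (g x) : EllTwo Γ →L[ℂ] EllTwo Γ) ξ) := by
    intro ξ
    obtain ⟨ζ, hζ, h⟩ := exists_central_vector (σ := σ) ξ
    refine ((hvec ζ).sub (hvec (pointMass 1))).congr fun x => ?_
    rw [Pi.sub_apply, ← inner_centerExpectation_apply hζ,
      ← inner_centerExpectation_apply σ.pointMass_one_mem_centralVectors,
      h _ (centerExpectation_mem_center _), add_sub_cancel_left]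
  simp only [inner_amplify_polarization _ ξ η]
  exact ((((hdiag _).sub (hdiag _)).sub (continuous_const.mul (hdiag _))).add
    (continuous_const.mul (hdiag _))).div_const _

variable (σ) in
theorem isNormalMap_centerExpectation : IsNormalMap σ.centerExpectation.toLinearMap := by
  refine continuous_induced_rng.2 ?_
  refine @continuous_ultraweak_rng _ _ _ _ ((ultraweakTopology (EllTwo Γ)).induced Subtype.val) _ ?_
  refine @continuous_inner_amplify_centerExpectation _ _ σ _
    ((ultraweakTopology (EllTwo Γ)).induced Subtype.val) id ?_
  intro ξ η
  exact @Continuous.comp _ _ _ ((ultraweakTopology (EllTwo Γ)).induced Subtype.val)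
    (ultraweakTopology (EllTwo Γ)) _ _ _ (continuous_inner_amplify ξ η) continuous_induced_dom

variable (σ) in
theorem isCenterValuedTrace_centerExpectation :
    σ.twistedVN.IsCenterValuedTrace σ.centerExpectation where
  normal := σ.isNormalMap_centerExpectation
  map_mul_comm := centerExpectation_mul_comm
  map_center_mul := centerExpectation_center_mul
  map_center := centerExpectation_of_mem_center
  faithful := centerExpectation_faithful

end TwoCocycle

end

/-! ### Uniqueness and the values on the unitaries -/

noncomputable section

open Filter Topology VonNeumannAlgebra

namespace VonNeumannAlgebra

variable {H : Type*} [NormedAddCommGroup H] [InnerProductSpace ℂ H]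

theorem tendsto_ultraweak {X : Type*} {l : Filter X} {f : X → H →L[ℂ] H} {c : H →L[ℂ] H}
    (h : ∀ ξ η, Tendsto (fun x => inner ℂ η (amplify (f x) ξ)) l (𝓝 (inner ℂ η (amplify c ξ)))) :
    Tendsto f l (@nhds _ (ultraweakTopology H) c) := by
  simp only [inner_amplify] at h
  simp only [nhds_iInf, nhds_induced, tendsto_iInf, tendsto_comap_iff]
  exact h

theorem ext_inner_amplify {a b : H →L[ℂ] H}
    (h : ∀ ξ η, inner ℂ η (amplify a ξ) = inner ℂ η (amplify b ξ)) : a = b := by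
  ext v
  refine ext_inner_left ℂ fun u => ?_
  rw [← inner_amplify_single, h, inner_amplify_single]

end VonNeumannAlgebra

namespace TwoCocycle

variable {Γ : Type*} [Group Γ] {σ : TwoCocycle Γ}
  {Tr : σ.twistedVN.toStarSubalgebra →L[ℂ] σ.twistedVN.centerVN.toStarSubalgebra}

theorem star_twistedUnitary_mul (x : Γ) : star (σ.twistedUnitary x) * σ.twistedUnitary x = 1 :=
  Subtype.ext (σ.star_leftRegular_mul x)

theorem twistedUnitary_mul_star (x : Γ) : σ.twistedUnitary x * star (σ.twistedUnitary x) = 1 :=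
  Subtype.ext (σ.leftRegular_mul_star x)

theorem trace_conjugate (hTr : σ.twistedVN.IsCenterValuedTrace Tr)
    (a : σ.twistedVN.toStarSubalgebra) (x : Γ) :
    Tr (σ.twistedUnitary x * a * star (σ.twistedUnitary x)) = Tr a := by
  rw [hTr.map_mul_comm, ← mul_assoc, star_twistedUnitary_mul, one_mul]

theorem trace_of_mem_conjugateAverages (hTr : σ.twistedVN.IsCenterValuedTrace Tr)
    (a : σ.twistedVN.toStarSubalgebra) {b : EllTwo Γ →L[ℂ] EllTwo Γ}
    (hb : b ∈ conjugateAverages σ.leftRegular (a : EllTwo Γ →L[ℂ] EllTwo Γ)) :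
    ∃ h : b ∈ σ.twistedVN.toStarSubalgebra, Tr ⟨b, h⟩ = Tr a := by
  refine conjugateAverages_induction hb (fun x => ?_) fun b c hb hc s t _ _ hst => ?_
  · exact ⟨conjugate_mem a.2 x, trace_conjugate hTr a x⟩
  · obtain ⟨hbM, hb⟩ := hb
    obtain ⟨hcM, hc⟩ := hc
    refine ⟨add_mem (σ.twistedVN.toStarSubalgebra.smul_mem hbM _)
      (σ.twistedVN.toStarSubalgebra.smul_mem hcM _), ?_⟩
    calc _ = Tr ((s : ℂ) • ⟨b, hbM⟩ + (t : ℂ) • ⟨c, hcM⟩) := rfl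
      _ = ((s + t : ℝ) : ℂ) • Tr a := by
        rw [map_add, map_smul, map_smul, hb, hc, ← add_smul, Complex.ofReal_add]
      _ = Tr a := by rw [hst, Complex.ofReal_one, one_smul]

/-- The trace takes the value `Tr a` on all averages of conjugates of `a`. A bounded sequence of
these converges strongly, hence ultraweakly, to `E(a)`, so normality gives `Tr a = Tr (E(a)) =
E(a)`. -/
theorem eq_centerExpectation (hTr : σ.twistedVN.IsCenterValuedTrace Tr) :
    Tr = σ.centerExpectation := by
  ext1 a
  obtain ⟨b, hb, hlim⟩ := exists_averages_tendsto_centerExpectation a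
  choose hbM hbTr using fun n => trace_of_mem_conjugateAverages hTr a (hb n)
  set e : σ.twistedVN.toStarSubalgebra := ⟨_, centerExpectation_mem a⟩
  have hTre : (Tr e : EllTwo Γ →L[ℂ] EllTwo Γ) = σ.centerExpectation a :=
    hTr.map_center e (centerExpectation_mem_center a)
  have hbe : Tendsto (fun n => (⟨b n, hbM n⟩ : σ.twistedVN.toStarSubalgebra)) atTop
      (@nhds _ ((ultraweakTopology (EllTwo Γ)).induced Subtype.val) e) := by
    rw [@nhds_induced _ _ (ultraweakTopology (EllTwo Γ)), tendsto_comap_iff]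
    exact tendsto_ultraweak (tendsto_inner_amplify
      (fun n => norm_le_of_mem_conjugateAverages σ.norm_leftRegular_le (hb n)) hlim)
  have hnormal := hTr.normal
  rw [IsNormalMap, continuous_induced_rng] at hnormal
  refine Subtype.ext (ext_inner_amplify fun ξ η => ?_)
  have h1 := ((@Continuous.tendsto _ _ (ultraweakTopology (EllTwo Γ)) _ _
    (continuous_inner_amplify ξ η) _).comp
      (@Continuous.tendsto _ _ ((ultraweakTopology (EllTwo Γ)).induced Subtype.val)
        (ultraweakTopology (EllTwo Γ)) _ hnormal e)).comp hbe
  have h2 : ∀ n, Tr.toLinearMap ⟨b n, hbM n⟩ = Tr a := hbTr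
  simp only [Function.comp_def, h2] at h1
  have h3 := tendsto_nhds_unique h1 tendsto_const_nhds
  rw [← h3, ← hTre]
  rfl

theorem centralVectors_apply_conjugate {f : EllTwo Γ} (hf : f ∈ σ.centralVectors) (x g : Γ) :
    (σ x g : ℂ) * f g = (σ (x * g * x⁻¹) x : ℂ) * f (x * g * x⁻¹) := by
  have h := congrArg (fun f : EllTwo Γ => f (x * g)) (mem_centralVectors.1 hf x)
  simpa [leftRegular_apply, rightRegular_apply] using h

theorem norm_centralVectors_apply_conjugate {f : EllTwo Γ} (hf : f ∈ σ.centralVectors)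
    (x g : Γ) : ‖f (x * g * x⁻¹)‖ = ‖f g‖ := by
  have h := congrArg norm (centralVectors_apply_conjugate hf x g)
  rw [norm_mul, norm_mul, Circle.norm_coe, Circle.norm_coe, one_mul, one_mul] at h
  exact h.symm

/-- The modulus of `f` is constant on the class, so `f γ ≠ 0` forces finiteness by
square-summability. If `y` commutes with `g` in the class, the relation `σ(y, g) f(g) = σ(g, y)
f(g)` then forces regularity. -/
theorem centralVectors_apply_eq_zero {f : EllTwo Γ} (hf : f ∈ σ.centralVectors) {γ : Γ}
    (hγ : ¬ ((conjugatesOf γ).Finite ∧ σ.IsRegularClass γ)) : f γ = 0 := by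
  have hconj : ∀ g ∈ conjugatesOf γ, ‖f g‖ = ‖f γ‖ := by
    intro g hg
    obtain ⟨x, rfl⟩ := isConj_iff.1 (show IsConj γ g from hg)
    exact norm_centralVectors_apply_conjugate hf x γ
  by_contra hne
  refine hγ ⟨?_, ?_⟩
  · have h := lp.memℓp f
    rw [memℓp_gen_iff (by norm_num)] at h
    have hpos : 0 < ‖f γ‖ ^ (2 : ℝ≥0∞).toReal := Real.rpow_pos_of_pos (norm_pos_iff.2 hne) _
    have hfin := h.tendsto_cofinite_zero.eventually (gt_mem_nhds hpos)
    refine Set.Finite.subset (eventually_cofinite.1 hfin) fun g hg => ?_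
    simp [hconj g hg]
  · intro g hg y hy
    have hfg : f g ≠ 0 := by
      rw [← norm_pos_iff, hconj g hg]
      exact norm_pos_iff.2 hne
    have h := centralVectors_apply_conjugate hf y g
    rw [hy.eq, mul_inv_cancel_right] at h
    exact (Subtype.ext (mul_right_cancel₀ hfg h)).symm

theorem centerExpectation_twistedUnitary_eq_zero {γ : Γ}
    (hγ : ¬ ((conjugatesOf γ).Finite ∧ σ.IsRegularClass γ)) :
    σ.centerExpectation (σ.twistedUnitary γ) = 0 := by
  refine Subtype.ext (eq_of_apply_pointMass_one_eq (centerExpectation_mem _) (zero_mem _) ?_)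
  rw [centerExpectation_apply_pointMass_one]
  refine Submodule.eq_starProjection_of_mem_of_inner_eq_zero (zero_mem _) fun w hw => ?_
  have e : ((σ.twistedUnitary γ : σ.twistedVN.toStarSubalgebra) : EllTwo Γ →L[ℂ] EllTwo Γ)
      (pointMass 1) = pointMass γ := σ.leftRegular_pointMass_one γ
  rw [e]
  change inner ℂ (pointMass γ - (0 : EllTwo Γ)) w = 0
  rw [sub_zero, inner_pointMass]
  exact centralVectors_apply_eq_zero hw hγ

theorem star_conjugate_conjugate (a : EllTwo Γ →L[ℂ] EllTwo Γ) (x y : Γ) :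
    star (σ.leftRegular y) * (star (σ.leftRegular x) * a * σ.leftRegular x) * σ.leftRegular y =
      star (σ.leftRegular (x * y)) * a * σ.leftRegular (x * y) := by
  have hc : star (σ x y : ℂ) * (σ x y : ℂ) = 1 := by
    rw [Complex.star_def, mul_comm, Complex.mul_conj]
    simp
  calc _ = star (σ.leftRegular x * σ.leftRegular y) * a *
        (σ.leftRegular x * σ.leftRegular y) := by
        rw [star_mul]
        simp only [mul_assoc]
    _ = (star (σ x y : ℂ) * (σ x y : ℂ)) •
        (star (σ.leftRegular (x * y)) * a * σ.leftRegular (x * y)) := by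
        rw [leftRegular_mul, star_smul, mul_smul_comm, smul_mul_assoc, smul_mul_assoc, smul_smul,
          mul_comm]
    _ = _ := by rw [hc, one_smul]

theorem star_conjugate_leftRegular (γ β : Γ) :
    star (σ.leftRegular β) * σ.leftRegular γ * σ.leftRegular β =
      ((σ γ β : ℂ) * conj (σ β (β⁻¹ * γ * β) : ℂ)) • σ.leftRegular (β⁻¹ * γ * β) := by
  have h1 := σ.leftRegular_mul β (β⁻¹ * γ * β)
  have e : β * (β⁻¹ * γ * β) = γ * β := by group
  have hc : conj (σ β (β⁻¹ * γ * β) : ℂ) * (σ β (β⁻¹ * γ * β) : ℂ) = 1 := by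
    rw [mul_comm, Complex.mul_conj]
    simp
  have h2 : σ.leftRegular (γ * β) = conj (σ β (β⁻¹ * γ * β) : ℂ) •
      (σ.leftRegular β * σ.leftRegular (β⁻¹ * γ * β)) := by
    rw [h1, smul_smul, hc, one_smul, e]
  rw [mul_assoc, leftRegular_mul, h2, mul_smul_comm, mul_smul_comm, ← mul_assoc,
    star_leftRegular_mul, one_mul, smul_smul]

/-- `β' β⁻¹` commutes with `γ`, and regularity lifts this to commutation of the unitaries; the
scalars from the products cancel. -/
theorem star_conjugate_eq_of_conjugate_eq {γ : Γ} (hγ : σ.IsRegular γ) {β β' : Γ}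
    (h : β⁻¹ * γ * β = β'⁻¹ * γ * β') :
    star (σ.leftRegular β) * σ.leftRegular γ * σ.leftRegular β =
      star (σ.leftRegular β') * σ.leftRegular γ * σ.leftRegular β' := by
  have hcomm : Commute (β' * β⁻¹) γ := by
    have h' : γ = β * (β'⁻¹ * γ * β') * β⁻¹ := by rw [← h]; group
    change β' * β⁻¹ * γ = γ * (β' * β⁻¹)
    conv_lhs => rw [h']
    group
  have hfix : star (σ.leftRegular (β' * β⁻¹)) * σ.leftRegular γ * σ.leftRegular (β' * β⁻¹) =
      σ.leftRegular γ := by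
    rw [mul_assoc, leftRegular_mul, hγ _ hcomm, ← hcomm.eq, ← leftRegular_mul, ← mul_assoc,
      star_leftRegular_mul, one_mul]
  have e : β' = β' * β⁻¹ * β := by group
  conv_rhs => rw [e, ← star_conjugate_conjugate, hfix]

/-- Conjugation by `λ(x)` replaces `β j` by `β j * x`, which permutes the conjugates of `γ`; by
regularity each term depends only on its conjugate, so the sum is unchanged. -/
theorem sum_conjugates_mem_center {γ : Γ} (hγ : σ.IsRegular γ) {k : ℕ} {β : Fin k → Γ}
    (hinj : Function.Injective fun j => (β j)⁻¹ * γ * β j)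
    (hrange : Set.range (fun j => (β j)⁻¹ * γ * β j) = conjugatesOf γ) :
    ∑ j, star (σ.leftRegular (β j)) * σ.leftRegular γ * σ.leftRegular (β j) ∈
      σ.twistedVN.centerVN := by
  refine σ.mem_center_of_commute_leftRegular (sum_mem fun j _ =>
    mul_mem (mul_mem (star_mem (σ.leftRegular_mem_twistedVN _)) (σ.leftRegular_mem_twistedVN _))
      (σ.leftRegular_mem_twistedVN _)) fun x => ?_
  set S := ∑ j, star (σ.leftRegular (β j)) * σ.leftRegular γ * σ.leftRegular (β j) with hS
  have hπ : ∀ j, ∃ i, (β i)⁻¹ * γ * β i = (β j * x)⁻¹ * γ * (β j * x) := by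
    intro j
    have h : (β j * x)⁻¹ * γ * (β j * x) ∈ conjugatesOf γ :=
      isConj_iff.2 ⟨(β j * x)⁻¹, by rw [inv_inv]⟩
    rw [← hrange] at h
    exact h
  choose π hπ using hπ
  have hπinj : Function.Injective π := by
    intro i j hij
    have h : (β i * x)⁻¹ * γ * (β i * x) = (β j * x)⁻¹ * γ * (β j * x) := by
      rw [← hπ, ← hπ, hij]
    refine hinj ?_
    calc (β i)⁻¹ * γ * β i = x * ((β i * x)⁻¹ * γ * (β i * x)) * x⁻¹ := by group
      _ = (β j)⁻¹ * γ * β j := by rw [h]; group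
  have hfix : star (σ.leftRegular x) * S * σ.leftRegular x = S := by
    rw [hS, Finset.mul_sum, Finset.sum_mul]
    refine Fintype.sum_bijective π (Finite.injective_iff_bijective.1 hπinj) _ _ fun j => ?_
    rw [star_conjugate_conjugate]
    exact star_conjugate_eq_of_conjugate_eq hγ (hπ j).symm
  calc σ.leftRegular x * S
      = σ.leftRegular x * (star (σ.leftRegular x) * S * σ.leftRegular x) := by rw [hfix]
    _ = S * σ.leftRegular x := by
        rw [← mul_assoc, ← mul_assoc, leftRegular_mul_star, one_mul]

/-- The central sum `S` is fixed by `Tr`, while traciality gives `Tr S = k Tr(λ(γ))`. -/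
theorem trace_twistedUnitary (hTr : σ.twistedVN.IsCenterValuedTrace Tr) {γ : Γ}
    (hγ : σ.IsRegular γ) {k : ℕ} {β : Fin k → Γ}
    (hinj : Function.Injective fun j => (β j)⁻¹ * γ * β j)
    (hrange : Set.range (fun j => (β j)⁻¹ * γ * β j) = conjugatesOf γ) :
    (Tr (σ.twistedUnitary γ) : EllTwo Γ →L[ℂ] EllTwo Γ) =
      ((conjugatesOf γ).ncard : ℂ)⁻¹ •
        ∑ j : Fin k, ((σ γ (β j) : ℂ) * conj (σ (β j) ((β j)⁻¹ * γ * β j) : ℂ)) •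
          σ.leftRegular ((β j)⁻¹ * γ * β j) := by
  have hcard : (conjugatesOf γ).ncard = k := by
    rw [← hrange, ← Set.image_univ, Set.ncard_image_of_injective _ hinj, Set.ncard_univ,
      Nat.card_eq_fintype_card, Fintype.card_fin]
  have hk : (k : ℂ) ≠ 0 := by
    have hγmem : γ ∈ conjugatesOf γ := mem_conjugatesOf_self
    rw [← hrange] at hγmem
    obtain ⟨j, _⟩ := hγmem
    have : NeZero k := ⟨by rintro rfl; exact j.elim0⟩
    exact NeZero.ne _
  set S : σ.twistedVN.toStarSubalgebra := ∑ j, star (σ.twistedUnitary (β j)) *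
    σ.twistedUnitary γ * σ.twistedUnitary (β j) with hS
  have hScoe : (S : EllTwo Γ →L[ℂ] EllTwo Γ) =
      ∑ j, star (σ.leftRegular (β j)) * σ.leftRegular γ * σ.leftRegular (β j) := by
    rw [hS, AddSubmonoidClass.coe_finsetSum]
    rfl
  have hTrS : Tr S = (k : ℂ) • Tr (σ.twistedUnitary γ) := by
    rw [hS, map_sum, Finset.sum_congr rfl fun j _ => ?_, Finset.sum_const, Finset.card_univ,
      Fintype.card_fin, Nat.cast_smul_eq_nsmul]
    rw [hTr.map_mul_comm, ← mul_assoc, twistedUnitary_mul_star, one_mul]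
  have hcenter := hTr.map_center S (hScoe ▸ sum_conjugates_mem_center hγ hinj hrange)
  have h : Tr (σ.twistedUnitary γ) = (k : ℂ)⁻¹ • Tr S := by
    rw [hTrS, smul_smul, inv_mul_cancel₀ hk, one_smul]
  rw [h, hcard]
  calc _ = (k : ℂ)⁻¹ • (Tr S : EllTwo Γ →L[ℂ] EllTwo Γ) := rfl
    _ = _ := by
      rw [hcenter, hScoe]
      simp only [star_conjugate_leftRegular]

end TwoCocycle

end

theorem proposition3p2 {Γ : Type*} [Group Γ] (σ : TwoCocycle Γ) :
    (∃! Tr : σ.twistedVN.toStarSubalgebra →L[ℂ] σ.twistedVN.centerVN.toStarSubalgebra,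
      σ.twistedVN.IsCenterValuedTrace Tr) ∧
    ∀ Tr : σ.twistedVN.toStarSubalgebra →L[ℂ] σ.twistedVN.centerVN.toStarSubalgebra,
      σ.twistedVN.IsCenterValuedTrace Tr →
      ∀ γ : Γ,
        ((conjugatesOf γ).Finite → σ.IsRegularClass γ →
          ∀ (k : ℕ) (β : Fin k → Γ),
            Function.Injective (fun j => (β j)⁻¹ * γ * β j) →
            Set.range (fun j => (β j)⁻¹ * γ * β j) = conjugatesOf γ →
            (Tr (σ.twistedUnitary γ) : EllTwo Γ →L[ℂ] EllTwo Γ) =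
              ((conjugatesOf γ).ncard : ℂ)⁻¹ •
                ∑ j : Fin k,
                  ((σ γ (β j) : ℂ) * conj (σ (β j) ((β j)⁻¹ * γ * β j) : ℂ)) •
                    σ.leftRegular ((β j)⁻¹ * γ * β j)) ∧
        (¬ ((conjugatesOf γ).Finite ∧ σ.IsRegularClass γ) →
          Tr (σ.twistedUnitary γ) = 0) := by
  refine ⟨⟨σ.centerExpectation, σ.isCenterValuedTrace_centerExpectation,
    fun Tr hTr => TwoCocycle.eq_centerExpectation hTr⟩, fun Tr hTr γ => ⟨?_, fun hγ => ?_⟩⟩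
  · intro _ hreg k β hinj hrange
    exact TwoCocycle.trace_twistedUnitary hTr (hreg γ mem_conjugatesOf_self) hinj hrange
  · rw [TwoCocycle.eq_centerExpectation hTr]
    exact TwoCocycle.centerExpectation_twistedUnitary_eq_zero hγ
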